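/- Let $\mathcal X$ be a metric space with metric $d_{\mathcal X}$, equipped with a $\sigma$-algebra for which open sets are measurable, and write $B(x,r)=\{x'\in\mathcal X: d_{\mathcal X}(x,x')\le r\}$. Let $\mathcal Y$ be a measurable space and let $\mathcal H$ be a reproducing kernel Hilbert space of real functions on $\mathcal Y$ with feature map $\Phi:\mathcal Y\to\mathcal H$ (so $f(y)=\langle f,\Phi(y)\rangle_{\mathcal H}$ for all $f\in\mathcal H$), assumed strongly measurable, and reproducing kernel $\ell(y,y')=\langle\Phi(y),\Phi(y')\rangle_{\mathcal H}$. For a probability measure $Q$ on $\mathcal Y$ let $\Phi(Q)=\int\Phi(y)\,dQ(y)\in\mathcal H$ be its mean embedding. Let $P$ be a probability measure on $\mathcal X$ and let $P(\cdot\mid x)$, $x\in\mathcal X$, be a Markov kernel from $\mathcal X$ to $\mathcal Y$. Let $(x_1,y_1),\dots,(x_n,y_n)$ be i.i.d. with $x_i\sim P$ and $y_i\mid x_i\sim P(\cdot\mid x_i)$. For $x\in\mathcal X$ and $k\in\{1,\dots,n\}$ let $\mathrm{NN}(x,k)\subset\{1,\dots,n\}$ be the set of indices of the $k$ covariates among $x_1,\dots,x_n$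 that are closest to $x$, where ties in distance are broken by a ranking of the indices $1,\dots,n$ that is the same for all $x$ and $k$ and that is either fixed or random and independent of the sample. Let $\hat P(\cdot\mid x)=\frac1k\sum_{j\in \mathrm{NN}(x,k)}\delta_{y_j}$ be the kNN conditional distribution. Assume the following. 1. There is $\lambda>0$ with $\|\Phi(P(\cdot\mid x))-\Phi(P(\cdot\mid x'))\|_{\mathcal H}\le\lambda\, d_{\mathcal X}(x,x')$ for all $x,x'\in\mathcal X$. 2. There is $C_{\rm ker}>0$ with $0\le\ell(y,y')\le C_{\rm ker}^2$ for all $y,y'\in\mathcal Y$. 3. There are $C_{\rm dist},r_{\max},d>0$ with $P(B(x,r))\le C_{\rm dist}\,\epsilon^{-d}P(B(x,\epsilon r))$ for all $x\in\mathcal X$, $0<r<r_{\max}$ and $0<\epsilon<1$. 4. The class $\{B(x,r):x\in\mathcal X,\ r>0\}$ of balls has finite Vapnik–Chervonenkis dimension $\mathcal V_{\mathcal B}>0$. Let $0<\delta<1$. Then, with probability at least $1-2\delta$, the bound $$\left\|\Phi(P(\cdot\mid x))-\Phi(\hat P(\cdot\mid x))\right\|_{\mathcal H}^2\le \frac{4C_{\rm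 ker}^2\bigl(1+4(\mathcal V_{\mathcal B}\ln n-\ln\delta)\bigr)}{k}+2\lambda^2r^2\left(\frac{3C_{\rm dist}}{P(B(x,r))}\cdot\frac kn\right)^{2/d}$$ holds simultaneously for all $x\in\mathcal X$, $k\in\{1,\dots,n\}$ and $0<r<r_{\max}$ satisfying $$k\ge\mathcal V_{\mathcal B}\ln(2n)+\ln(8/\delta)\quad\text{and}\quad\frac kn<\frac{P(B(x,r))}{3C_{\rm dist}}.$$ -/

import Mathlib

open MeasureTheory ProbabilityTheory
open scoped ENNReal RealInnerProductSpace

namespace KNN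

/-- The feature map `y ↦ Φ(y)` of a reproducing kernel Hilbert space `H` of real functions on `𝒴`:
`Φ(y)` is the element of `H` with `f y = ⟪f, Φ(y)⟫` for all `f`. -/
noncomputable def featureMap {𝒴 : Type*} (H : Type*) [NormedAddCommGroup H]
    [InnerProductSpace ℝ H] [CompleteSpace H] [RKHS ℝ H 𝒴 ℝ] (y : 𝒴) : H :=
  RKHS.kerFun H y (1 : ℝ)

/-- The reproducing kernel `ℓ(y, y') = ⟪Φ(y), Φ(y')⟫`. -/
noncomputable def reproducingKernel {𝒴 : Type*} (H : Type*) [NormedAddCommGroup H]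
    [InnerProductSpace ℝ H] [CompleteSpace H] [RKHS ℝ H 𝒴 ℝ] (y y' : 𝒴) : ℝ :=
  ⟪featureMap H y, featureMap H y'⟫

/-- The mean embedding `Φ(P) = ∫ Φ(y) dP(y)` of a measure `P` on `𝒴`, a Bochner integral in `H`. -/
noncomputable def meanEmbedding {𝒴 : Type*} [MeasurableSpace 𝒴] (H : Type*)
    [NormedAddCommGroup H] [InnerProductSpace ℝ H] [CompleteSpace H] [RKHS ℝ H 𝒴 ℝ]
    (P : Measure 𝒴) : H :=
  ∫ y, featureMap H y ∂P

/-- The class of all closed balls of positive radius of a metric space. -/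
def balls (𝒳 : Type*) [MetricSpace 𝒳] : Set (Set 𝒳) :=
  {B | ∃ (x : 𝒳) (r : ℝ), 0 < r ∧ B = Metric.closedBall x r}

/-- A class `𝓑` of sets shatters a finite set `s` if every subset of `s` is cut out of `s` by a
member of `𝓑`. -/
def Shatters {α : Type*} (𝓑 : Set (Set α)) (s : Finset α) : Prop :=
  ∀ t : Set α, t ⊆ (s : Set α) → ∃ B ∈ 𝓑, (s : Set α) ∩ B = t

/-- The Vapnik–Chervonenkis dimension of a class of sets: the supremum, possibly infinite, of the
cardinalities of the finite sets that it shatters. -/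
noncomputable def vcDim {α : Type*} (𝓑 : Set (Set α)) : ℕ∞ :=
  ⨆ (s : Finset α) (_ : Shatters 𝓑 s), (s.card : ℕ∞)

/-- The unit `i` comes before the unit `j` as a neighbour of `x`: it is strictly closer to `x`, or
it is equally close and comes first in the ranking `τ` of the units. -/
def Before {𝒳 : Type*} [MetricSpace 𝒳] {n : ℕ} (xs : Fin n → 𝒳) (τ : Equiv.Perm (Fin n))
    (x : 𝒳) (i j : Fin n) : Prop :=
  dist x (xs i) < dist x (xs j) ∨ (dist x (xs i) = dist x (xs j) ∧ τ i < τ j)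

open Classical in
/-- The indices of the `k` nearest neighbours of `x` among `xs`, ties in distance being broken by
the ranking `τ`: those units that have fewer than `k` units before them. -/
noncomputable def nearest {𝒳 : Type*} [MetricSpace 𝒳] {n : ℕ} (xs : Fin n → 𝒳)
    (τ : Equiv.Perm (Fin n)) (k : ℕ) (x : 𝒳) : Finset (Fin n) :=
  Finset.univ.filter fun j => (Finset.univ.filter fun i => Before xs τ x i j).card < k

/-- The kNN conditional distribution at `x`: the empirical distribution of the responses of the
`k` nearest neighbours of `x`. -/
noncomputable def knnDist {𝒳 𝒴 : Type*} [MetricSpace 𝒳] [MeasurableSpace 𝒴] {n : ℕ}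
    (xs : Fin n → 𝒳) (ys : Fin n → 𝒴) (τ : Equiv.Perm (Fin n)) (k : ℕ) (x : 𝒳) : Measure 𝒴 :=
  (k : ℝ≥0∞)⁻¹ • ∑ j ∈ nearest xs τ k x, Measure.dirac (ys j)

/-- All sets of rankings of the finitely many units are measurable. -/
instance instMeasurableSpacePermFin (n : ℕ) : MeasurableSpace (Equiv.Perm (Fin n)) := ⊤

end KNN

/-! The proof is a bias–variance split made uniform in `x`, `k` and `r`. Put `L = V ln n - ln δ`.
Since the kernel is nonnegative, two averages of feature vectors are at squared distance at most `2
* Cker ^ 2`, so the bound is trivial when `k ≤ 2 + 8 * L`. For larger `k`, which forces `25 ≤ k ≤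
n`, two exceptional events of probability at most `δ` each suffice.

Variance. Given the covariates, the centred features over a fixed index set `A` are independent.
Orthogonality bounds the mean norm of their sum by `C * √|A|`, and McDiarmid's inequality controls
the deviation from that mean (`measureReal_pi_lt_norm_sum_le`). Every nearest-neighbour set is the
trace of an open ball joined with an initial segment, in the ranking, of the trace of a closed ball.
By Sauer–Shelah only polynomially many such sets exist, and a union bound applies
(`pi_exists_candidates_lt_norm_sum_le`). An independent random ranking is handled one value at a
time.

Bias. Doubling gives a ball of radius `ε * r` about `x` with mass at least `3 * k / n`, where `ε ^ d
= 3 * Cdist * k / (n * P(B(x,r)))`. Symmetrization with a ghost sample and random swaps shows that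
all balls of such mass contain `k` covariates at once (`measureReal_pi_exists_pointCount_lt_le`).
The neighbours then lie within `ε * r`, and the Lipschitz condition bounds the bias by `lam * ε *
r`.

Measurability. The space need not be separable, but the points all of whose balls have positive mass
form a separable set, and doubling puts every relevant `x` in it. Countably many balls with rational
radii then produce all the traces required. -/

namespace KNN

/-! ### Traces of a class of sets and the Sauer–Shelah bound -/

open Classical in
/-- The subsets of the index set of a finite family of points that are cut out by the members of a
class of sets. -/
noncomputable def traces {α ι : Type*} [Fintype ι] (𝓑 : Set (Set α)) (xs : ι → α) :
    Finset (Finset ι) :=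
  Finset.univ.filter fun A => ∃ B ∈ 𝓑, A = Finset.univ.filter fun i => xs i ∈ B

lemma sum_range_choose_le (n V : ℕ) :
    ∑ k ∈ Finset.range (V + 1), n.choose k ≤ (n + 1) ^ V := by
  induction V with
  | zero => simp
  | succ V ih =>
    rw [Finset.sum_range_succ]
    have h1 : n.choose (V + 1) ≤ n ^ (V + 1) := Nat.choose_le_pow n (V + 1)
    have h2 : n ^ V ≤ (n + 1) ^ V := Nat.pow_le_pow_left n.le_succ V
    calc _ ≤ (n + 1) ^ V + n ^ V * n := by rw [← pow_succ]; omega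
      _ ≤ (n + 1) ^ V + (n + 1) ^ V * n := by gcongr
      _ = (n + 1) ^ (V + 1) := by ring

/-- Sauer–Shelah is applied to the set family on the index set, so that repeated points cause no
trouble: a shattered set of indices maps injectively to a shattered set of points. -/
lemma card_traces_le {α ι : Type*} [Fintype ι] {𝓑 : Set (Set α)} {V : ℕ}
    (hV : ∀ s : Finset α, Shatters 𝓑 s → s.card ≤ V) (xs : ι → α) :
    (traces 𝓑 xs).card ≤ (Fintype.card ι + 1) ^ V := by
  classical
  have hdim : (traces 𝓑 xs).vcDim ≤ V := by
    refine Finset.sup_le fun s hs => ?_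
    rw [Finset.mem_shatterer] at hs
    have key : ∀ t ⊆ s, ∃ B ∈ 𝓑, ∀ i ∈ s, (xs i ∈ B ↔ i ∈ t) := by
      intro t ht
      obtain ⟨u, hu, hst⟩ := hs ht
      simp only [traces, Finset.mem_filter, Finset.mem_univ, true_and] at hu
      obtain ⟨B, hB, rfl⟩ := hu
      refine ⟨B, hB, fun i hi => ?_⟩
      rw [← hst]
      simp [hi]
    -- A set that cuts out exactly the index `i` separates `xs i` from the points at all other
    -- indices of `s`.
    have hinj : Set.InjOn xs s := by
      intro i hi j hj hij
      obtain ⟨B, -, hB⟩ := key {i} (by simpa using hi)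
      have h1 := (hB i hi).2 (by simp)
      rw [hij] at h1
      simpa [eq_comm] using (hB j hj).1 h1
    rw [← Finset.card_image_of_injOn hinj]
    refine hV _ fun t ht => ?_
    obtain ⟨B, hB, h⟩ := key (s.filter fun i => xs i ∈ t) (Finset.filter_subset _ _)
    refine ⟨B, hB, ?_⟩
    ext y
    constructor
    · rintro ⟨hy, hyB⟩
      obtain ⟨i, hi, rfl⟩ := by simpa using hy
      exact (Finset.mem_filter.1 ((h i hi).1 hyB)).2
    · intro hy
      have hys := ht hy
      obtain ⟨i, hi, rfl⟩ := by simpa using hys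
      exact ⟨hys, (h i hi).2 (by simp [hi, hy])⟩
  calc (traces 𝓑 xs).card ≤ (traces 𝓑 xs).shatterer.card := Finset.card_le_card_shatterer _
    _ ≤ ∑ k ∈ Finset.Iic (traces 𝓑 xs).vcDim, (Fintype.card ι).choose k :=
      Finset.card_shatterer_le_sum_vcDim
    _ ≤ ∑ k ∈ Finset.range (V + 1), (Fintype.card ι).choose k := by
      refine Finset.sum_le_sum_of_subset fun k hk => ?_
      rw [Finset.mem_Iic] at hk
      rw [Finset.mem_range]
      omega
    _ ≤ _ := sum_range_choose_le _ _

/-! ### Structure of the set of nearest neighbours -/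

section Nearest

variable {𝒳 : Type*} [MetricSpace 𝒳] {n : ℕ} (xs : Fin n → 𝒳) (τ : Equiv.Perm (Fin n)) (x : 𝒳)

/-- The position of a unit among the neighbours of `x`, as an element of a linear order. -/
noncomputable def neighbourKey (j : Fin n) : ℝ ×ₗ Fin n := toLex (dist x (xs j), τ j)

lemma before_iff {i j : Fin n} :
    Before xs τ x i j ↔ neighbourKey xs τ x i < neighbourKey xs τ x j := by
  rw [Before, neighbourKey, neighbourKey, Prod.Lex.toLex_lt_toLex]

lemma neighbourKey_injective : Function.Injective (neighbourKey xs τ x) := fun i j h => by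
  have h' := congrArg (fun p => (ofLex p).2) h
  exact τ.injective h'

open Classical in
/-- The number of units that come before a given one as neighbours of `x`. -/
noncomputable def neighbourRank (j : Fin n) : ℕ :=
  (Finset.univ.filter fun i => Before xs τ x i j).card

lemma neighbourRank_strictMono {i j : Fin n}
    (h : neighbourKey xs τ x i < neighbourKey xs τ x j) :
    neighbourRank xs τ x i < neighbourRank xs τ x j := by
  classical
  refine Finset.card_lt_card ⟨fun l hl => ?_, fun hsub => ?_⟩
  · simp only [Finset.mem_filter, Finset.mem_univ, true_and, before_iff] at hl ⊢
    exact hl.trans h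
  · have : i ∈ Finset.univ.filter fun l => Before xs τ x l i :=
      hsub (by simpa [before_iff] using h)
    simp [before_iff] at this

lemma neighbourRank_le_iff {i j : Fin n} :
    neighbourRank xs τ x i ≤ neighbourRank xs τ x j ↔
      neighbourKey xs τ x i ≤ neighbourKey xs τ x j := by
  constructor
  · intro h
    by_contra! h'
    exact absurd (neighbourRank_strictMono xs τ x h') (by omega)
  · intro h
    rcases h.lt_or_eq with h | h
    · exact (neighbourRank_strictMono xs τ x h).le
    · rw [neighbourKey_injective xs τ x h]

lemma neighbourRank_lt (j : Fin n) : neighbourRank xs τ x j < n := by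
  classical
  have : (Finset.univ.filter fun i => Before xs τ x i j).card < (Finset.univ : Finset (Fin n)).card :=
    Finset.card_lt_card (Finset.filter_ssubset.2 ⟨j, Finset.mem_univ _, by simp [before_iff]⟩)
  simpa [neighbourRank] using this

/-- The keys are totally ordered without ties, so the ranks are exactly `0, …, n - 1`. This yields
both the cardinality of a neighbour set and the existence of a `k`-th neighbour. -/
lemma neighbourRank_bijective :
    Function.Bijective fun j => (⟨neighbourRank xs τ x j, neighbourRank_lt xs τ x j⟩ : Fin n) := by
  rw [← Finite.injective_iff_bijective]
  intro i j h
  have h' : neighbourRank xs τ x i = neighbourRank xs τ x j := by simpa using h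
  exact neighbourKey_injective xs τ x (le_antisymm
    ((neighbourRank_le_iff xs τ x).1 h'.le) ((neighbourRank_le_iff xs τ x).1 h'.ge))

lemma mem_nearest {k : ℕ} {j : Fin n} :
    j ∈ nearest xs τ k x ↔ neighbourRank xs τ x j < k := by
  classical
  simp [nearest, neighbourRank]

lemma card_nearest {k : ℕ} (hk : k ≤ n) : (nearest xs τ k x).card = k := by
  classical
  have h : (nearest xs τ k x).card = (Finset.univ.filter fun i : Fin n => (i : ℕ) < k).card := by
    refine Finset.card_bijective _ (neighbourRank_bijective xs τ x) fun j => ?_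
    simp [mem_nearest]
  rw [h, Fin.card_filter_val_lt, min_eq_right hk]

open Classical in
/-- The nearest neighbours are the units in an open ball together with those units in the closed
ball of the same radius that are ranked before a certain unit. -/
lemma exists_nearest_eq {k : ℕ} (hk1 : 1 ≤ k) (hk : k ≤ n) :
    ∃ j₀ : Fin n, nearest xs τ k x =
      Finset.univ.filter (fun j => dist x (xs j) < dist x (xs j₀)) ∪
        (Finset.univ.filter fun j => dist x (xs j) ≤ dist x (xs j₀)).filter
          fun j => τ j ≤ τ j₀ := by
  -- The witness is the `k`-th neighbour, whose rank is `k - 1` because ranks start at zero. Using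
  -- the closed ball instead of the sphere in the second piece adds only units that are already in
  -- the open ball.
  obtain ⟨j₀, hj₀⟩ := (neighbourRank_bijective xs τ x).2 ⟨k - 1, by omega⟩
  have hr : neighbourRank xs τ x j₀ = k - 1 := by simpa using hj₀
  refine ⟨j₀, ?_⟩
  ext j
  rw [mem_nearest, show neighbourRank xs τ x j < k ↔
    neighbourRank xs τ x j ≤ neighbourRank xs τ x j₀ by omega, neighbourRank_le_iff,
    neighbourKey, neighbourKey, Prod.Lex.toLex_le_toLex]
  simp only [Finset.mem_union, Finset.mem_filter, Finset.mem_univ, true_and]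
  grind

open Classical in
/-- If at least `k` units lie within distance `ρ` of `x`, then so do the `k` nearest neighbours. -/
lemma dist_le_of_mem_nearest {k : ℕ} {ρ : ℝ}
    (hk : k ≤ (Finset.univ.filter fun i => dist x (xs i) ≤ ρ).card) {j : Fin n}
    (hj : j ∈ nearest xs τ k x) : dist x (xs j) ≤ ρ := by
  by_contra! h
  rw [mem_nearest] at hj
  refine absurd (hk.trans (Finset.card_le_card (t := Finset.univ.filter fun i => Before xs τ x i j)
    fun i hi => ?_)) (not_le.2 hj)
  simp only [Finset.mem_filter, Finset.mem_univ, true_and] at hi ⊢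
  exact Or.inl (hi.trans_lt h)

end Nearest

/-! ### Concentration for functions of independent variables -/

section Concentration

variable {β : Type*} [MeasurableSpace β]

lemma measurable_finCons {m : ℕ} :
    Measurable fun p : β × (Fin m → β) => (Fin.cons p.1 p.2 : Fin (m + 1) → β) := by
  refine measurable_pi_lambda _ fun i => ?_
  refine Fin.cases ?_ (fun j => ?_) i
  · simpa using measurable_fst
  · simp only [Fin.cons_succ]
    exact (measurable_pi_apply j).comp measurable_snd

lemma measurePreserving_finCons {m : ℕ} (ν : Fin (m + 1) → Measure β)
    [∀ i, IsProbabilityMeasure (ν i)] :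
    MeasurePreserving (fun p : β × (Fin m → β) => (Fin.cons p.1 p.2 : Fin (m + 1) → β))
      ((ν 0).prod (Measure.pi fun i => ν i.succ)) (Measure.pi ν) := by
  refine ⟨measurable_finCons, (Measure.pi_eq fun s hs => ?_).symm⟩
  rw [Measure.map_apply measurable_finCons (MeasurableSet.univ_pi hs), Fin.prod_univ_succ,
    ← Measure.pi_pi, ← Measure.prod_prod]
  congr 1
  ext p
  simp [Fin.forall_fin_succ]

lemma integral_pi_succ {E : Type*} [NormedAddCommGroup E] [NormedSpace ℝ E] {m : ℕ}
    (ν : Fin (m + 1) → Measure β) [∀ i, IsProbabilityMeasure (ν i)]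
    {f : (Fin (m + 1) → β) → E} (hf : StronglyMeasurable f) {M : ℝ} (hM : ∀ y, ‖f y‖ ≤ M) :
    ∫ y, f y ∂Measure.pi ν =
      ∫ z, ∫ y, f (Fin.cons z y) ∂(Measure.pi fun i : Fin m => ν i.succ) ∂ν 0 := by
  rw [← (measurePreserving_finCons ν).map_eq,
    integral_map measurable_finCons.aemeasurable hf.aestronglyMeasurable, integral_prod]
  exact Integrable.of_bound (hf.comp_measurable measurable_finCons).aestronglyMeasurable M
    (.of_forall fun p => hM _)

/-- Pythagoras: independent centred vectors are orthogonal in mean square. The offset `v` lets the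
induction absorb the first coordinate into the constant. -/
lemma integral_norm_add_sum_sq {H : Type*} [NormedAddCommGroup H] [InnerProductSpace ℝ H]
    [CompleteSpace H] {m : ℕ} (ν : Fin m → Measure β) [∀ i, IsProbabilityMeasure (ν i)]
    {g : Fin m → β → H} (hg : ∀ i, StronglyMeasurable (g i)) {M : ℝ}
    (hM : ∀ i y, ‖g i y‖ ≤ M) (h0 : ∀ i, ∫ y, g i y ∂ν i = 0) (v : H) :
    ∫ y, ‖v + ∑ i, g i (y i)‖ ^ 2 ∂Measure.pi ν = ‖v‖ ^ 2 + ∑ i, ∫ y, ‖g i y‖ ^ 2 ∂ν i := by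
  induction m generalizing v with
  | zero => simp
  | succ m ih =>
    have hsm : StronglyMeasurable fun y : Fin (m + 1) → β => ‖v + ∑ i, g i (y i)‖ ^ 2 :=
      ((stronglyMeasurable_const.add (Finset.stronglyMeasurable_fun_sum _ fun i _ =>
        (hg i).comp_measurable (measurable_pi_apply i))).norm).pow 2
    have hint : Integrable (g 0) (ν 0) :=
      Integrable.of_bound (hg 0).aestronglyMeasurable M (.of_forall (hM 0))
    have hint2 : Integrable (fun z => ‖g 0 z‖ ^ 2) (ν 0) := by
      refine Integrable.of_bound ((hg 0).norm.pow 2).aestronglyMeasurable (M ^ 2)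
        (.of_forall fun z => ?_)
      rw [Real.norm_of_nonneg (by positivity)]
      exact pow_le_pow_left₀ (norm_nonneg _) (hM 0 z) 2
    rw [integral_pi_succ ν hsm (M := (‖v‖ + ∑ _i : Fin (m + 1), M) ^ 2)]
    · simp only [Fin.sum_univ_succ, Fin.cons_zero, Fin.cons_succ, ← add_assoc]
      have h1 : ∀ z, ∫ y, ‖v + g 0 z + ∑ i : Fin m, g i.succ (y i)‖ ^ 2
          ∂(Measure.pi fun i : Fin m => ν i.succ) =
          ‖v + g 0 z‖ ^ 2 + ∑ i : Fin m, ∫ y, ‖g i.succ y‖ ^ 2 ∂ν i.succ := fun z =>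
        ih (fun i => ν i.succ) (fun i => hg i.succ) (fun i => hM i.succ) (fun i => h0 i.succ) _
      simp only [h1]
      simp only [norm_add_sq_real]
      rw [integral_add _ (integrable_const _), integral_add _ hint2, integral_add
        (integrable_const _) ((hint.const_inner v).const_mul 2), integral_const_mul,
        integral_inner hint, h0]
      · simp
      · exact (integrable_const _).add ((hint.const_inner v).const_mul 2)
      · exact ((integrable_const _).add ((hint.const_inner v).const_mul 2)).add hint2
    · intro y
      rw [Real.norm_of_nonneg (by positivity)]
      refine pow_le_pow_left₀ (norm_nonneg _) ((norm_add_le _ _).trans ?_) 2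
      gcongr
      exact (norm_sum_le _ _).trans (Finset.sum_le_sum fun i _ => hM i _)

/-- Hoeffding's lemma for a function whose oscillation is bounded. -/
lemma integral_exp_sub_integral_le (ν : Measure β) [IsProbabilityMeasure ν] {g : β → ℝ}
    (hg : Measurable g) {M : ℝ} (hM : ∀ z, |g z| ≤ M) {c : ℝ} (hc : ∀ z z', |g z - g z'| ≤ c)
    (s : ℝ) : ∫ z, Real.exp (s * (g z - ∫ z, g z ∂ν)) ∂ν ≤ Real.exp (s ^ 2 * c ^ 2 / 8) := by
  have : Nonempty β := nonempty_of_isProbabilityMeasure ν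
  have hbdd : BddBelow (Set.range g) := ⟨-M, by rintro _ ⟨z, rfl⟩; exact (abs_le.1 (hM z)).1⟩
  -- Bounded oscillation puts the range of `g` in an interval of length `c` starting at its infimum.
  have h := (hasSubgaussianMGF_of_mem_Icc (μ := ν) (X := g) (a := ⨅ z, g z)
    (b := (⨅ z, g z) + c) hg.aemeasurable (.of_forall fun z => ⟨ciInf_le hbdd z, by
      rw [← sub_le_iff_le_add]
      exact le_ciInf fun z' => by linarith [(abs_le.1 (hc z z')).2]⟩)).mgf_le s
  simp only [mgf] at h
  refine h.trans (Real.exp_le_exp.2 (le_of_eq ?_))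
  push_cast
  rw [Real.norm_eq_abs, add_sub_cancel_left, div_pow, sq_abs]
  ring

/-- McDiarmid's inequality, in the form of a bound on the moment generating function. -/
lemma integral_exp_sub_integral_pi_le {m : ℕ} (ν : Fin m → Measure β)
    [∀ i, IsProbabilityMeasure (ν i)] {f : (Fin m → β) → ℝ} (hf : Measurable f) {M : ℝ}
    (hM : ∀ y, |f y| ≤ M) {c : Fin m → ℝ}
    (hc : ∀ i y z, |f y - f (Function.update y i z)| ≤ c i) (s : ℝ) :
    ∫ y, Real.exp (s * (f y - ∫ y, f y ∂Measure.pi ν)) ∂Measure.pi ν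
      ≤ Real.exp (s ^ 2 * (∑ i, c i ^ 2) / 8) := by
  induction m with
  | zero =>
    have hconst : f = fun _ => f default := funext fun y => congrArg f (Subsingleton.elim _ _)
    rw [hconst]
    simp
  | succ m ih =>
    set π : Measure (Fin m → β) := Measure.pi fun i => ν i.succ with hπ
    -- `g` is the conditional mean of `f` given the first coordinate. The deviation of `f` splits
    -- into `f - g`, handled by induction for each fixed first coordinate, and `g` minus its mean,
    -- handled by Hoeffding's lemma.
    set g : β → ℝ := fun z => ∫ y, f (Fin.cons z y) ∂π with hg_def
    have hfc : StronglyMeasurable fun p : β × (Fin m → β) => f (Fin.cons p.1 p.2) :=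
      (hf.comp measurable_finCons).stronglyMeasurable
    have hg : Measurable g := hfc.integral_prod_right.measurable
    have hfz : ∀ z, Measurable fun y : Fin m → β => f (Fin.cons z y) := fun z =>
      hfc.measurable.comp measurable_prodMk_left
    have hfi : ∀ z, Integrable (fun y : Fin m → β => f (Fin.cons z y)) π := fun z =>
      Integrable.of_bound (hfz z).aestronglyMeasurable M (.of_forall fun y => hM _)
    have hgM : ∀ z, |g z| ≤ M := fun z => by
      have := norm_integral_le_of_norm_le_const (μ := π) (f := fun y => f (Fin.cons z y))
        (C := M) (.of_forall fun y => hM _)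
      simpa using this
    have hgc : ∀ z z', |g z - g z'| ≤ c 0 := fun z z' => by
      rw [hg_def]
      simp only
      rw [← integral_sub (hfi z) (hfi z')]
      have := norm_integral_le_of_norm_le_const (μ := π)
        (f := fun y => f (Fin.cons z y) - f (Fin.cons z' y)) (C := c 0) (.of_forall fun y => by
          simpa [Fin.update_cons_zero] using hc 0 (Fin.cons z y) z')
      simpa using this
    have hmean : ∫ y, f y ∂Measure.pi ν = ∫ z, g z ∂ν 0 :=
      integral_pi_succ ν hf.stronglyMeasurable hM
    have hstep : ∀ z, ∫ y, Real.exp (s * (f (Fin.cons z y) - g z)) ∂π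
        ≤ Real.exp (s ^ 2 * (∑ i : Fin m, c i.succ ^ 2) / 8) := fun z => by
      refine ih (fun i => ν i.succ) (hfz z) (fun y => hM _) fun i y w => ?_
      rw [Fin.cons_update]
      exact hc i.succ _ w
    have hbound : ∀ a b : ℝ, |a| ≤ M → |b| ≤ M → Real.exp (s * (a - b)) ≤
        Real.exp (|s| * (2 * M)) := fun a b ha hb => by
      refine Real.exp_le_exp.2 ((le_abs_self _).trans ?_)
      rw [abs_mul]
      gcongr
      linarith [abs_sub a b]
    rw [hmean, integral_pi_succ ν (M := Real.exp (|s| * (2 * M)))]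
    · calc ∫ z, ∫ y, Real.exp (s * (f (Fin.cons z y) - ∫ z, g z ∂ν 0)) ∂π ∂ν 0
          = ∫ z, Real.exp (s * (g z - ∫ z, g z ∂ν 0)) *
              ∫ y, Real.exp (s * (f (Fin.cons z y) - g z)) ∂π ∂ν 0 := by
            refine integral_congr_ae (.of_forall fun z => ?_)
            simp only
            rw [← integral_const_mul]
            refine integral_congr_ae (.of_forall fun y => ?_)
            simp only
            rw [← Real.exp_add]
            congr 1
            ring
        _ ≤ ∫ z, Real.exp (s * (g z - ∫ z, g z ∂ν 0)) *
              Real.exp (s ^ 2 * (∑ i : Fin m, c i.succ ^ 2) / 8) ∂ν 0 := by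
            refine integral_mono_of_nonneg (.of_forall fun z => ?_) ?_ (.of_forall fun z => ?_)
            · exact mul_nonneg (Real.exp_pos _).le (integral_nonneg fun y => (Real.exp_pos _).le)
            · refine Integrable.mul_const ?_ _
              refine Integrable.of_bound (by fun_prop) (Real.exp (|s| * (2 * M)))
                (.of_forall fun z => ?_)
              rw [Real.norm_of_nonneg (Real.exp_pos _).le]
              refine hbound _ _ (hgM z) ?_
              have := norm_integral_le_of_norm_le_const (μ := ν 0) (f := g)
                (C := M) (.of_forall hgM)
              simpa using this
            · exact mul_le_mul_of_nonneg_left (hstep z) (Real.exp_pos _).le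
        _ ≤ Real.exp (s ^ 2 * c 0 ^ 2 / 8) *
              Real.exp (s ^ 2 * (∑ i : Fin m, c i.succ ^ 2) / 8) := by
            rw [integral_mul_const]
            gcongr
            exact integral_exp_sub_integral_le (ν 0) hg hgM hgc s
        _ = Real.exp (s ^ 2 * (∑ i, c i ^ 2) / 8) := by
            rw [← Real.exp_add, Fin.sum_univ_succ]
            congr 1
            ring
    · exact (by fun_prop : Measurable _).stronglyMeasurable
    · intro y
      rw [Real.norm_of_nonneg (Real.exp_pos _).le]
      refine hbound _ _ (hM y) ?_
      have := norm_integral_le_of_norm_le_const (μ := ν 0) (f := g)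
        (C := M) (.of_forall hgM)
      simpa using this

/-- McDiarmid's inequality. -/
lemma measureReal_pi_ge_le {m : ℕ} (ν : Fin m → Measure β)
    [∀ i, IsProbabilityMeasure (ν i)] {f : (Fin m → β) → ℝ} (hf : Measurable f) {M : ℝ}
    (hM : ∀ y, |f y| ≤ M) {c : Fin m → ℝ}
    (hc : ∀ i y z, |f y - f (Function.update y i z)| ≤ c i) {t : ℝ} (ht : 0 ≤ t) :
    (Measure.pi ν).real {y | t ≤ f y - ∫ y, f y ∂Measure.pi ν}
      ≤ Real.exp (-2 * t ^ 2 / ∑ i, c i ^ 2) := by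
  have hsub : HasSubgaussianMGF (fun y => f y - ∫ y, f y ∂Measure.pi ν)
      ⟨(∑ i, c i ^ 2) / 4, by positivity⟩ (Measure.pi ν) := by
    refine ⟨fun s => ?_, fun s => ?_⟩
    · refine Integrable.of_bound (by fun_prop) (Real.exp (|s| * (M + |∫ y, f y ∂Measure.pi ν|)))
        (.of_forall fun y => ?_)
      rw [Real.norm_of_nonneg (Real.exp_pos _).le]
      refine Real.exp_le_exp.2 ((le_abs_self _).trans ?_)
      rw [abs_mul]
      gcongr
      exact (abs_sub _ _).trans (by gcongr; exact hM y)
    · refine (integral_exp_sub_integral_pi_le ν hf hM hc s).trans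
        (Real.exp_le_exp.2 (le_of_eq ?_))
      change _ = (∑ i, c i ^ 2) / 4 * s ^ 2 / 2
      ring
  refine (hsub.measure_ge_le ht).trans (Real.exp_le_exp.2 (le_of_eq ?_))
  change -t ^ 2 / (2 * ((∑ i, c i ^ 2) / 4)) = _
  rw [show 2 * ((∑ i, c i ^ 2) / 4) = (∑ i, c i ^ 2) / 2 by ring, div_div_eq_mul_div]
  ring

end Concentration

/-! ### Independent pairs as a product of kernels -/

section PiKernel

variable {𝒳 𝒴 ι : Type*} [MeasurableSpace 𝒳] [MeasurableSpace 𝒴] [Fintype ι]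

/-- The Markov kernel under which the responses are independent given the covariates. -/
noncomputable def piKernel (ι : Type*) [Fintype ι] (κ : Kernel 𝒳 𝒴) [IsMarkovKernel κ] :
    Kernel (ι → 𝒳) (ι → 𝒴) where
  toFun xs := Measure.pi fun i => κ (xs i)
  measurable' := by
    refine Measurable.measure_of_isPiSystem_of_isProbabilityMeasure generateFrom_pi.symm
      isPiSystem_pi ?_
    rintro _ ⟨s, hs, rfl⟩
    simp only [Measure.pi_pi]
    exact Finset.measurable_fun_prod _ fun i _ =>
      (κ.measurable_coe (hs i (Set.mem_univ i))).comp (measurable_pi_apply i)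

lemma piKernel_apply (κ : Kernel 𝒳 𝒴) [IsMarkovKernel κ] (xs : ι → 𝒳) :
    piKernel ι κ xs = Measure.pi fun i => κ (xs i) := rfl

instance (κ : Kernel 𝒳 𝒴) [IsMarkovKernel κ] : IsMarkovKernel (piKernel ι κ) :=
  ⟨fun xs => by rw [piKernel_apply]; infer_instance⟩

lemma lintegral_pi_prod (P : Measure 𝒳) [IsProbabilityMeasure P] {f : ι → 𝒳 → ℝ≥0∞}
    (hf : ∀ i, Measurable (f i)) :
    ∫⁻ xs, ∏ i, f i (xs i) ∂Measure.pi (fun _ : ι => P) = ∏ i, ∫⁻ x, f i x ∂P := by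
  rw [lintegral_prod_eq_prod_lintegral_of_indepFun Finset.univ (fun i (xs : ι → 𝒳) => f i (xs i))
    (iIndepFun_pi fun i => (hf i).aemeasurable) fun i => (hf i).comp (measurable_pi_apply i)]
  refine Finset.prod_congr rfl fun i _ => ?_
  exact (measurePreserving_eval (fun _ : ι => P) i).lintegral_comp (hf i)

lemma pi_compProd (P : Measure 𝒳) [IsProbabilityMeasure P] (κ : Kernel 𝒳 𝒴) [IsMarkovKernel κ] :
    (Measure.pi (fun _ : ι => P) ⊗ₘ piKernel ι κ).map (fun p i => (p.1 i, p.2 i)) =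
      Measure.pi fun _ : ι => P ⊗ₘ κ := by
  have hmeas : Measurable fun (p : (ι → 𝒳) × (ι → 𝒴)) (i : ι) => (p.1 i, p.2 i) := by fun_prop
  refine (Measure.pi_eq fun s hs => ?_).symm
  rw [Measure.map_apply hmeas (MeasurableSet.univ_pi hs),
    Measure.compProd_apply (hmeas (MeasurableSet.univ_pi hs))]
  simp only [Measure.compProd_apply (hs _)]
  rw [← lintegral_pi_prod P fun i => Kernel.measurable_kernel_prodMk_left (hs i)]
  refine lintegral_congr fun xs => ?_
  rw [piKernel_apply, ← Measure.pi_pi]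
  congr 1

/-- Conditioning on the covariates: once they are frozen, the candidate neighbour sets form a fixed
finite family and the responses are independent, so a bound uniform in the covariates integrates to
the same bound. -/
lemma pi_compProd_le (P : Measure 𝒳) [IsProbabilityMeasure P] (κ : Kernel 𝒳 𝒴)
    [IsMarkovKernel κ] {G : Set (ι → 𝒳 × 𝒴)} (hG : MeasurableSet G) {c : ℝ≥0∞}
    (h : ∀ xs : ι → 𝒳, Measure.pi (fun i => κ (xs i)) {ys | (fun i => (xs i, ys i)) ∈ G} ≤ c) :
    Measure.pi (fun _ : ι => P ⊗ₘ κ) G ≤ c := by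
  have hmeas : Measurable fun (p : (ι → 𝒳) × (ι → 𝒴)) (i : ι) => (p.1 i, p.2 i) := by fun_prop
  rw [← pi_compProd, Measure.map_apply hmeas hG, Measure.compProd_apply (hmeas hG)]
  calc _ ≤ ∫⁻ _ : ι → 𝒳, c ∂Measure.pi (fun _ : ι => P) := lintegral_mono fun xs => h xs
    _ = c := by simp

end PiKernel

/-! ### Relative deviation bound for a countable Vapnik–Chervonenkis class -/

section Deviation

open Classical in
/-- The number of points of a finite family that lie in a set. -/
noncomputable def pointCount {α ι : Type*} [Fintype ι] (B : Set α) (xs : ι → α) : ℕ :=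
  (Finset.univ.filter fun i => xs i ∈ B).card

lemma measurable_pointCount {α ι : Type*} [MeasurableSpace α] [Fintype ι] {B : Set α}
    (hB : MeasurableSet B) : Measurable fun xs : ι → α => pointCount B xs := by
  classical
  simp only [pointCount, Finset.card_filter]
  exact Finset.measurable_fun_sum _ fun i _ =>
    Measurable.ite ((measurable_pi_apply i) hB) measurable_const measurable_const

/-- Chebyshev. With `p` the mass of `B`, a count below `5 * k / 2 ≤ 5 * n * p / 6` misses its mean
by at least `n * p / 6`, while its variance is at most `n * p`. The probability is thus at most `36
/ (n * p)`, and `n * p ≥ 3 * k ≥ 72`. -/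
lemma measureReal_pi_pointCount_lt_le {𝒳 : Type*} [MeasurableSpace 𝒳] (P : Measure 𝒳)
    [IsProbabilityMeasure P] {n k : ℕ} {B : Set 𝒳} (hB : MeasurableSet B) (hk : 24 ≤ k)
    (hBk : 3 * (k : ℝ) ≤ n * P.real B) :
    (Measure.pi fun _ : Fin n => P).real {xs | 2 * pointCount B xs < 5 * k} ≤ 1 / 2 := by
  classical
  set p := P.real B with hp
  set g : 𝒳 → ℝ := fun x => B.indicator 1 x - p with hg
  have hgm : Measurable g := (measurable_one.indicator hB).sub_const p
  have hp0 : 0 ≤ p := measureReal_nonneg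
  have hp1 : p ≤ 1 := measureReal_le_one
  have hgM : ∀ x, ‖g x‖ ≤ 1 := fun x => by
    rw [Real.norm_eq_abs, abs_le, hg]
    by_cases hx : x ∈ B <;> (simp [hx]; constructor <;> linarith)
  have hind : Integrable (B.indicator (1 : 𝒳 → ℝ)) P :=
    (integrable_const (1 : ℝ)).indicator hB
  have hg0 : ∫ x, g x ∂P = 0 := by
    rw [hg, integral_sub hind (integrable_const _), integral_indicator_one hB]
    simp [hp]
  have hg2 : ∫ x, ‖g x‖ ^ 2 ∂P ≤ p := by
    have h1 : ∀ x, ‖g x‖ ^ 2 = (1 - 2 * p) * B.indicator 1 x + p ^ 2 := fun x => by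
      rw [Real.norm_eq_abs, sq_abs, hg]
      by_cases hx : x ∈ B <;> simp [hx] <;> ring
    simp only [h1]
    rw [integral_add (hind.const_mul _) (integrable_const _), integral_const_mul,
      integral_indicator_one hB]
    simp only [integral_const, probReal_univ, smul_eq_mul, one_mul, ← hp]
    nlinarith
  have hmom := integral_norm_add_sum_sq (fun _ : Fin n => P) (g := fun _ => g)
    (fun _ => hgm.stronglyMeasurable) (fun _ => hgM) (fun _ => hg0) 0
  have hsum : ∀ xs : Fin n → 𝒳, (0 : ℝ) + ∑ i, g (xs i) = pointCount B xs - n * p := fun xs => by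
    simp only [hg, Finset.sum_sub_distrib, pointCount, Finset.card_filter, Set.indicator_apply]
    simp
  simp only [hsum, Real.norm_eq_abs, sq_abs] at hmom
  have hk' : (24 : ℝ) ≤ k := by exact_mod_cast hk
  have hmarkov := mul_meas_ge_le_integral_of_nonneg (μ := Measure.pi fun _ : Fin n => P)
    (f := fun xs => ((pointCount B xs : ℝ) - n * p) ^ 2) (.of_forall fun xs => sq_nonneg _) (by
      have hm := measurable_pointCount (ι := Fin n) hB
      refine Integrable.of_bound (C := (n + n * p) ^ 2) ?_ (.of_forall fun xs => ?_)
      · exact (((measurable_of_countable (fun m : ℕ => (m : ℝ))).comp hm).sub_const _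
          |>.pow_const 2).aestronglyMeasurable
      · rw [Real.norm_of_nonneg (sq_nonneg _)]
        have h1 : pointCount B xs ≤ n := by
          simpa [pointCount] using Finset.card_filter_le (Finset.univ : Finset (Fin n)) _
        have h2 : (pointCount B xs : ℝ) ≤ n := by exact_mod_cast h1
        have h3 : (0 : ℝ) ≤ pointCount B xs := Nat.cast_nonneg _
        have h4 : 0 ≤ n * p := by positivity
        exact sq_le_sq' (by linarith) (by linarith)) ((n * p / 6) ^ 2)
  rw [hmom] at hmarkov
  have hle : (Measure.pi fun _ : Fin n => P).real {xs | 2 * pointCount B xs < 5 * k} ≤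
      (Measure.pi fun _ : Fin n => P).real
        {xs | (n * p / 6) ^ 2 ≤ ((pointCount B xs : ℝ) - n * p) ^ 2} := by
    refine measureReal_mono fun xs hxs => ?_
    have h1 : 2 * (pointCount B xs : ℝ) < 5 * k := by exact_mod_cast hxs
    have h2 : 0 ≤ n * p := by positivity
    simp only [Set.mem_ofPred_eq]
    nlinarith
  have hfin : (0 : ℝ) ^ 2 + ∑ _i : Fin n, ∫ y, ‖g y‖ ^ 2 ∂P ≤ n * p := by
    simp only [Finset.sum_const, Finset.card_univ, Fintype.card_fin, nsmul_eq_mul]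
    nlinarith [Nat.cast_nonneg (α := ℝ) n]
  refine hle.trans ?_
  set m := (Measure.pi fun _ : Fin n => P).real
        {xs | (n * p / 6) ^ 2 ≤ ((pointCount B xs : ℝ) - n * p) ^ 2}
  have h3 : (n * p / 6) ^ 2 * m ≤ n * p := by
    refine hmarkov.trans (le_trans (le_of_eq ?_) hfin)
    simp
  have h4 : 72 ≤ n * p := by linarith
  have hm0 : 0 ≤ m := measureReal_nonneg
  have h5 : n * p * m ≤ 36 := by
    by_contra! h
    nlinarith
  nlinarith

/-- Randomly exchanging the members of pairs is unlikely to place few of the first members but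
many of the second members in a given set. -/
lemma card_swap_le {ι : Type*} [Fintype ι] [DecidableEq ι] (T : Finset (ι × Bool)) (k : ℕ) :
    ((Finset.univ.filter fun σ : ι → Bool =>
      (Finset.univ.filter fun i => (i, σ i) ∈ T).card < k ∧
        5 * k ≤ 2 * (Finset.univ.filter fun i => (i, !σ i) ∈ T).card).card : ℝ) ≤
      2 ^ Fintype.card ι * (25 / 14 * (5 / 6) ^ 5) ^ k := by
  -- An exponential-moment argument. The weights `14 / 25` and `(6 / 5) ^ 2 = 36 / 25` sum to `2`,
  -- so each pair contributes at most `2` when summed over its two orders, whether none, one or both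
  -- members lie in `T`. The square allows `5 * k ≤ 2 * _` to be used without halves.
  set w : ι → Bool → ℝ := fun i b =>
    (if (i, b) ∈ T then 14 / 25 else 1) * (if (i, !b) ∈ T then (6 / 5) ^ 2 else 1) with hw
  have hw0 : ∀ i b, 0 ≤ w i b := fun i b => by
    simp only [hw]
    split_ifs <;> positivity
  have hprod : ∀ σ : ι → Bool, ∏ i, w i (σ i) =
      (14 / 25) ^ (Finset.univ.filter fun i => (i, σ i) ∈ T).card *
        (6 / 5) ^ (2 * (Finset.univ.filter fun i => (i, !σ i) ∈ T).card) := fun σ => by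
    simp only [hw]
    rw [Finset.prod_mul_distrib, Finset.prod_ite, Finset.prod_ite]
    simp only [Finset.prod_const, one_pow, mul_one, pow_mul]
  have hsum : ∑ σ : ι → Bool, ∏ i, w i (σ i) ≤ 2 ^ Fintype.card ι := by
    rw [← Fintype.prod_sum]
    refine (Finset.prod_le_prod (fun i _ => Finset.sum_nonneg fun b _ => hw0 i b)
      (g := fun _ => (2 : ℝ)) fun i _ => ?_).trans (by simp)
    simp only [hw, Fintype.sum_bool, Bool.not_true, Bool.not_false]
    split_ifs <;> norm_num
  rw [Finset.card_filter]
  push_cast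
  refine le_trans ?_ (mul_le_mul_of_nonneg_right hsum (by positivity))
  rw [Finset.sum_mul]
  refine Finset.sum_le_sum fun σ _ => ?_
  split_ifs with h
  · rw [hprod]
    have h1 : ((14 : ℝ) / 25) ^ k ≤
        (14 / 25) ^ (Finset.univ.filter fun i => (i, σ i) ∈ T).card :=
      pow_le_pow_of_le_one (by norm_num) (by norm_num) h.1.le
    have h2 : ((6 : ℝ) / 5) ^ (5 * k) ≤
        (6 / 5) ^ (2 * (Finset.univ.filter fun i => (i, !σ i) ∈ T).card) :=
      pow_le_pow_right₀ (by norm_num) h.2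
    calc (1 : ℝ) = (14 / 25) ^ k * (6 / 5) ^ (5 * k) * (25 / 14 * (5 / 6) ^ 5) ^ k := by
          rw [pow_mul, ← mul_pow, ← mul_pow]
          norm_num
      _ ≤ _ := by gcongr
  · exact mul_nonneg (Finset.prod_nonneg fun i _ => hw0 i _) (by positivity)

/-- Exchange the members of the pairs selected by `σ`. -/
def swapPairs {α ι : Type*} (σ : ι → Bool) (z : ι → α × α) (i : ι) : α × α :=
  if σ i then (z i).swap else z i

lemma measurePreserving_swapPairs {α ι : Type*} [MeasurableSpace α] [Fintype ι] (P : Measure α)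
    [IsProbabilityMeasure P] (σ : ι → Bool) :
    MeasurePreserving (swapPairs σ) (Measure.pi fun _ : ι => P.prod P)
      (Measure.pi fun _ : ι => P.prod P) := by
  refine measurePreserving_pi (fun _ : ι => P.prod P) (fun _ : ι => P.prod P)
    (f := fun i z => if σ i then z.swap else z) fun i => ?_
  cases h : σ i
  · simpa [h] using! MeasurePreserving.id _
  · simpa [h] using Measure.measurePreserving_swap

-- The `2 n` points are the same whatever `σ` is, so a union bound over their traces reduces the
-- claim to one fixed subset of the pooled points.
open Classical in
lemma card_swapPairs_le {α ι : Type*} [Fintype ι] {𝓒 : Set (Set α)} {V : ℕ}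
    (hV : ∀ s : Finset α, Shatters 𝓒 s → s.card ≤ V) (k : ℕ) (z : ι → α × α) :
    ((Finset.univ.filter fun σ : ι → Bool => ∃ B ∈ 𝓒,
      pointCount B (fun i => (swapPairs σ z i).1) < k ∧
        5 * k ≤ 2 * pointCount B (fun i => (swapPairs σ z i).2)).card : ℝ) ≤
      2 ^ Fintype.card ι *
        ((2 * Fintype.card ι + 1) ^ V * (25 / 14 * (5 / 6) ^ 5) ^ k) := by
  set w : ι × Bool → α := fun p => if p.2 then (z p.1).2 else (z p.1).1 with hw
  have h1 : ∀ σ i, (swapPairs σ z i).1 = w (i, σ i) := fun σ i => by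
    cases h : σ i <;> simp [swapPairs, hw, h]
  have h2 : ∀ σ i, (swapPairs σ z i).2 = w (i, !σ i) := fun σ i => by
    cases h : σ i <;> simp [swapPairs, hw, h]
  simp only [h1, h2]
  have hsub : (Finset.univ.filter fun σ : ι → Bool => ∃ B ∈ 𝓒,
      pointCount B (fun i => w (i, σ i)) < k ∧
        5 * k ≤ 2 * pointCount B (fun i => w (i, !σ i))) ⊆
      (traces 𝓒 w).biUnion fun T => Finset.univ.filter fun σ : ι → Bool =>
        (Finset.univ.filter fun i => (i, σ i) ∈ T).card < k ∧
          5 * k ≤ 2 * (Finset.univ.filter fun i => (i, !σ i) ∈ T).card := by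
    intro σ hσ
    simp only [Finset.mem_filter, Finset.mem_univ, true_and] at hσ
    obtain ⟨B, hB, hlt, hle⟩ := hσ
    simp only [Finset.mem_biUnion]
    refine ⟨Finset.univ.filter fun p => w p ∈ B, ?_, ?_⟩
    · simp only [traces, Finset.mem_filter, Finset.mem_univ, true_and]
      exact ⟨B, hB, rfl⟩
    · simpa [pointCount] using And.intro hlt hle
  calc _ ≤ (((traces 𝓒 w).biUnion fun T => Finset.univ.filter fun σ : ι → Bool =>
        (Finset.univ.filter fun i => (i, σ i) ∈ T).card < k ∧
          5 * k ≤ 2 * (Finset.univ.filter fun i => (i, !σ i) ∈ T).card).card : ℝ) := by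
        exact_mod_cast Finset.card_le_card hsub
    _ ≤ ∑ T ∈ traces 𝓒 w, ((Finset.univ.filter fun σ : ι → Bool =>
        (Finset.univ.filter fun i => (i, σ i) ∈ T).card < k ∧
          5 * k ≤ 2 * (Finset.univ.filter fun i => (i, !σ i) ∈ T).card).card : ℝ) := by
        exact_mod_cast Finset.card_biUnion_le
    _ ≤ ∑ _T ∈ traces 𝓒 w, 2 ^ Fintype.card ι * (25 / 14 * (5 / 6 : ℝ) ^ 5) ^ k :=
        Finset.sum_le_sum fun T _ => card_swap_le T k
    _ = (traces 𝓒 w).card * (2 ^ Fintype.card ι * (25 / 14 * (5 / 6 : ℝ) ^ 5) ^ k) := by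
        rw [Finset.sum_const, nsmul_eq_mul]
    _ ≤ (2 * Fintype.card ι + 1) ^ V *
        (2 ^ Fintype.card ι * (25 / 14 * (5 / 6 : ℝ) ^ 5) ^ k) := by
        gcongr
        have := card_traces_le hV w
        rw [Fintype.card_prod, Fintype.card_bool, mul_comm] at this
        exact_mod_cast this
    _ = _ := by ring

lemma measurableSet_exists_pointCount {α ι : Type*} [MeasurableSpace α] [Fintype ι]
    {𝓒 : Set (Set α)} (hcount : 𝓒.Countable) (hmeas : ∀ B ∈ 𝓒, MeasurableSet B) (k : ℕ) :
    MeasurableSet {z : ι → α × α | ∃ B ∈ 𝓒,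
      pointCount B (fun i => (z i).1) < k ∧ 5 * k ≤ 2 * pointCount B (fun i => (z i).2)} := by
  have h : {z : ι → α × α | ∃ B ∈ 𝓒,
      pointCount B (fun i => (z i).1) < k ∧ 5 * k ≤ 2 * pointCount B (fun i => (z i).2)} =
      ⋃ B ∈ 𝓒, {z | pointCount B (fun i => (z i).1) < k} ∩
        {z | 5 * k ≤ 2 * pointCount B (fun i => (z i).2)} := by
    ext z
    simp [and_left_comm]
  rw [h]
  refine MeasurableSet.biUnion hcount fun B hB => ?_
  have hm := measurable_pointCount (ι := ι) (hmeas B hB)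
  have h1 : Measurable fun z : ι → α × α => pointCount B (fun i => (z i).1) :=
    hm.comp (by fun_prop)
  have h2 : Measurable fun z : ι → α × α => pointCount B (fun i => (z i).2) :=
    hm.comp (by fun_prop)
  exact (measurableSet_lt h1 measurable_const).inter
    (measurableSet_le measurable_const (h2.const_mul 2))

/-- Each swap preserves the law of the pairs, so the probability equals its average over all `σ`.
Interchanging sum and integral leaves a count of swaps for fixed points. -/
lemma measureReal_pi_prod_le {α ι : Type*} [MeasurableSpace α] [Fintype ι] (P : Measure α)
    [IsProbabilityMeasure P] {𝓒 : Set (Set α)} (hcount : 𝓒.Countable)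
    (hmeas : ∀ B ∈ 𝓒, MeasurableSet B) {V : ℕ}
    (hV : ∀ s : Finset α, Shatters 𝓒 s → s.card ≤ V) (k : ℕ) :
    (Measure.pi fun _ : ι => P.prod P).real {z | ∃ B ∈ 𝓒,
      pointCount B (fun i => (z i).1) < k ∧ 5 * k ≤ 2 * pointCount B (fun i => (z i).2)} ≤
      (2 * Fintype.card ι + 1) ^ V * (25 / 14 * (5 / 6) ^ 5) ^ k := by
  classical
  set π := Measure.pi fun _ : ι => P.prod P with hπ
  set G : Set (ι → α × α) := {z | ∃ B ∈ 𝓒,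
      pointCount B (fun i => (z i).1) < k ∧ 5 * k ≤ 2 * pointCount B (fun i => (z i).2)} with hG_def
  have hG : MeasurableSet G := measurableSet_exists_pointCount hcount hmeas k
  have hσ : ∀ σ : ι → Bool, π.real G = ∫ z, G.indicator 1 (swapPairs σ z) ∂π := fun σ => by
    have hmp := measurePreserving_swapPairs P σ
    rw [← integral_indicator_one hG]
    conv_lhs => rw [hπ, ← hmp.map_eq]
    exact integral_map hmp.measurable.aemeasurable
      (measurable_one.indicator hG).aestronglyMeasurable
  have hint : ∀ σ : ι → Bool, Integrable (fun z => G.indicator (1 : (ι → α × α) → ℝ) (swapPairs σ z)) π :=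
    fun σ => Integrable.of_bound (C := 1) ((measurable_one.indicator hG).comp
      (measurePreserving_swapPairs P σ).measurable).aestronglyMeasurable (.of_forall fun z => by
        by_cases h : swapPairs σ z ∈ G <;> simp [h])
  have hsum : 2 ^ Fintype.card ι * π.real G =
      ∫ z, ∑ σ : ι → Bool, G.indicator 1 (swapPairs σ z) ∂π := by
    rw [integral_finsetSum _ fun σ _ => hint σ]
    simp only [← hσ]
    simp
  have hle : ∫ z, ∑ σ : ι → Bool, G.indicator (1 : (ι → α × α) → ℝ) (swapPairs σ z) ∂π ≤
      ∫ _z, 2 ^ Fintype.card ι *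
        ((2 * Fintype.card ι + 1) ^ V * (25 / 14 * (5 / 6 : ℝ) ^ 5) ^ k) ∂π := by
    refine integral_mono (integrable_finsetSum _ fun σ _ => hint σ) (integrable_const _)
      fun z => le_trans (le_of_eq ?_) (card_swapPairs_le hV k z)
    rw [Finset.card_filter]
    push_cast
    refine Finset.sum_congr rfl fun σ _ => ?_
    simp [Set.indicator_apply, hG_def]
  rw [← hsum, integral_const, probReal_univ, one_smul] at hle
  exact le_of_mul_le_mul_left hle (by positivity)

/-- With high probability every member of a countable Vapnik–Chervonenkis class that has
probability at least `3 k / n` contains at least `k` of `n` independent points. -/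
lemma measureReal_pi_exists_pointCount_lt_le {𝒳 : Type*} [MeasurableSpace 𝒳] (P : Measure 𝒳)
    [IsProbabilityMeasure P] {𝓒 : Set (Set 𝒳)} (hcount : 𝓒.Countable)
    (hmeas : ∀ B ∈ 𝓒, MeasurableSet B) {V : ℕ}
    (hV : ∀ s : Finset 𝒳, Shatters 𝓒 s → s.card ≤ V) {n k : ℕ} (hk : 24 ≤ k) :
    MeasurableSet {xs : Fin n → 𝒳 | ∃ B ∈ 𝓒, 3 * (k : ℝ) ≤ n * P.real B ∧ pointCount B xs < k} ∧
    (Measure.pi fun _ : Fin n => P).real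
      {xs | ∃ B ∈ 𝓒, 3 * (k : ℝ) ≤ n * P.real B ∧ pointCount B xs < k} ≤
      2 * ((2 * n + 1) ^ V * (25 / 14 * (5 / 6) ^ 5) ^ k) := by
  set π := Measure.pi fun _ : Fin n => P with hπ
  set A := {xs : Fin n → 𝒳 | ∃ B ∈ 𝓒, 3 * (k : ℝ) ≤ n * P.real B ∧ pointCount B xs < k} with hA_def
  have hA : MeasurableSet A := by
    have h : A = ⋃ B ∈ 𝓒, {xs | 3 * (k : ℝ) ≤ n * P.real B} ∩ {xs | pointCount B xs < k} := by
      ext xs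
      simp [hA_def, and_left_comm]
    rw [h]
    exact MeasurableSet.biUnion hcount fun B hB => (MeasurableSet.const _).inter
      (measurableSet_lt (measurable_pointCount (hmeas B hB)) measurable_const)
  refine ⟨hA, ?_⟩
  set G : Set (Fin n → 𝒳 × 𝒳) := {z | ∃ B ∈ 𝓒,
      pointCount B (fun i => (z i).1) < k ∧ 5 * k ≤ 2 * pointCount B (fun i => (z i).2)} with hG_def
  have hG : MeasurableSet G := measurableSet_exists_pointCount hcount hmeas k
  have hmp := (measurePreserving_arrowProdEquivProdArrow 𝒳 𝒳 (Fin n) (fun _ => P)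
    (fun _ => P)).symm
  have hGπ : (Measure.pi fun _ : Fin n => P.prod P) G =
      ∫⁻ xs, π {ys | (fun i => (xs i, ys i)) ∈ G} ∂π := by
    rw [← hmp.measure_preimage hG.nullMeasurableSet,
      Measure.prod_apply (hmp.measurable hG)]
    rfl
  -- If some `B` is underfilled by the first sample, that same `B` receives at least `5 * k / 2`
  -- points of an independent second sample with probability at least one half.
  have hhalf : ∀ xs ∈ A, (1 / 2 : ℝ≥0∞) ≤ π {ys | (fun i => (xs i, ys i)) ∈ G} := by
    rintro xs ⟨B, hB, hBk, hlt⟩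
    have h1 := measureReal_pi_pointCount_lt_le P (hmeas B hB) hk hBk
    have hms : MeasurableSet {ys : Fin n → 𝒳 | 2 * pointCount B ys < 5 * k} :=
      measurableSet_lt ((measurable_pointCount (hmeas B hB)).const_mul 2) measurable_const
    have h2 : 1 / 2 ≤ π.real {ys : Fin n → 𝒳 | 2 * pointCount B ys < 5 * k}ᶜ := by
      rw [probReal_compl_eq_one_sub hms]
      linarith
    calc (1 / 2 : ℝ≥0∞) = ENNReal.ofReal (1 / 2) := by
          rw [ENNReal.ofReal_div_of_pos (by norm_num)]; simp
      _ ≤ π {ys : Fin n → 𝒳 | 2 * pointCount B ys < 5 * k}ᶜ := by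
          rw [← ofReal_measureReal]
          exact ENNReal.ofReal_le_ofReal h2
      _ ≤ _ := by
          refine measure_mono fun ys hys => ?_
          simp only [Set.mem_compl_iff, Set.mem_ofPred_eq, not_lt] at hys
          exact ⟨B, hB, hlt, hys⟩
  have hkey : (1 / 2 : ℝ≥0∞) * π A ≤ (Measure.pi fun _ : Fin n => P.prod P) G := by
    rw [hGπ, ← lintegral_indicator_const hA]
    refine lintegral_mono fun xs => ?_
    by_cases h : xs ∈ A
    · simpa [h] using hhalf xs h
    · simp [h]
  have hreal : 1 / 2 * π.real A ≤ (Measure.pi fun _ : Fin n => P.prod P).real G := by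
    have := ENNReal.toReal_mono (measure_ne_top _ _) hkey
    simpa [Measure.real] using this
  have hfin := measureReal_pi_prod_le (ι := Fin n) P hcount hmeas hV k
  rw [Fintype.card_fin] at hfin
  linarith [hreal.trans hfin]

end Deviation

/-! ### Deviation of sums of independent Hilbert space valued variables -/

section Variance

variable {β : Type*} [MeasurableSpace β] {H : Type*} [NormedAddCommGroup H]

lemma integrable_of_norm_le (ν : Measure β) [IsFiniteMeasure ν] {φ : β → H}
    (hφ : StronglyMeasurable φ) {C : ℝ} (hC : ∀ y, ‖φ y‖ ≤ C) : Integrable φ ν :=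
  Integrable.of_bound hφ.aestronglyMeasurable C (.of_forall hC)

variable [InnerProductSpace ℝ H]

lemma norm_integral_le_of_norm_le (ν : Measure β) [IsProbabilityMeasure ν] {φ : β → H} {C : ℝ}
    (hC : ∀ y, ‖φ y‖ ≤ C) : ‖∫ y, φ y ∂ν‖ ≤ C := by
  simpa using norm_integral_le_of_norm_le_const (μ := ν) (.of_forall hC)

variable [CompleteSpace H]

lemma integral_norm_sub_integral_sq_le (ν : Measure β) [IsProbabilityMeasure ν] {φ : β → H}
    (hφ : StronglyMeasurable φ) {C : ℝ} (hC : ∀ y, ‖φ y‖ ≤ C) :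
    ∫ y, ‖φ y - ∫ y, φ y ∂ν‖ ^ 2 ∂ν ≤ C ^ 2 := by
  have hint := integrable_of_norm_le ν hφ hC
  have hle : ∀ y, ‖φ y‖ ^ 2 ≤ C ^ 2 := fun y => pow_le_pow_left₀ (norm_nonneg _) (hC y) 2
  have hint2 : Integrable (fun y => ‖φ y‖ ^ 2) ν := by
    refine Integrable.of_bound (hφ.norm.pow 2).aestronglyMeasurable (C ^ 2) (.of_forall fun y => ?_)
    rw [Real.norm_of_nonneg (by positivity)]
    exact hle y
  set m := ∫ y, φ y ∂ν with hm
  have h1 : ∀ y, ‖φ y - m‖ ^ 2 = ‖φ y‖ ^ 2 - 2 * ⟪m, φ y⟫ + ‖m‖ ^ 2 := fun y => by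
    rw [norm_sub_sq_real, real_inner_comm]
  simp only [h1]
  rw [integral_add (f := fun y => ‖φ y‖ ^ 2 - 2 * ⟪m, φ y⟫)
    (hint2.sub ((hint.const_inner m).const_mul 2)) (integrable_const _),
    integral_sub hint2 ((hint.const_inner m).const_mul 2), integral_const_mul, integral_inner hint,
    ← hm, real_inner_self_eq_norm_sq]
  have h2 : ∫ y, ‖φ y‖ ^ 2 ∂ν ≤ C ^ 2 := by
    calc _ ≤ ∫ _y, C ^ 2 ∂ν := integral_mono hint2 (integrable_const _) hle
      _ = _ := by simp
  simp only [integral_const, probReal_univ, one_smul]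
  nlinarith [sq_nonneg ‖m‖]

/-- The mean of the norm is at most `C * √|A|`. Changing one response moves it by at most `√2 * C`,
and McDiarmid with `t = C * √|A| * √L` then gives exactly `exp (-L)`. -/
lemma measureReal_pi_lt_norm_sum_le {n : ℕ} (ν : Fin n → Measure β)
    [∀ i, IsProbabilityMeasure (ν i)] {φ : β → H} (hφ : StronglyMeasurable φ) {C : ℝ}
    (hC0 : 0 < C) (hC : ∀ y, ‖φ y‖ ≤ C) (hosc : ∀ y y', ‖φ y - φ y'‖ ^ 2 ≤ 2 * C ^ 2)
    (A : Finset (Fin n)) {L : ℝ} (hL : 0 ≤ L) :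
    (Measure.pi ν).real {ys | C * √A.card * (1 + √L) <
      ‖∑ j ∈ A, (φ (ys j) - ∫ y, φ y ∂ν j)‖} ≤ Real.exp (-L) := by
  classical
  rcases A.eq_empty_or_nonempty with rfl | hA
  · simp [(Real.exp_pos _).le]
  have hcard : (0 : ℝ) < A.card := by exact_mod_cast hA.card_pos
  -- Extension by zero outside `A` turns the sum into one over all coordinates.
  set g : Fin n → β → H := fun i y => if i ∈ A then φ y - ∫ y, φ y ∂ν i else 0 with hg_def
  set f : (Fin n → β) → ℝ := fun ys => ‖∑ j ∈ A, (φ (ys j) - ∫ y, φ y ∂ν j)‖ with hf_def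
  have hfm : StronglyMeasurable f := (Finset.stronglyMeasurable_fun_sum _ fun i _ =>
    (hφ.comp_measurable (measurable_pi_apply i)).sub stronglyMeasurable_const).norm
  have hfg : ∀ ys, f ys = ‖(0 : H) + ∑ i, g i (ys i)‖ := fun ys => by
    simp [hf_def, hg_def, Finset.sum_ite_mem]
  have hdiff : ∀ i y, ‖φ y - ∫ y, φ y ∂ν i‖ ≤ 2 * C := fun i y =>
    (norm_sub_le _ _).trans (by linarith [hC y, norm_integral_le_of_norm_le (ν i) hC])
  have hfM : ∀ ys, |f ys| ≤ A.card * (2 * C) := fun ys => by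
    rw [abs_of_nonneg (norm_nonneg _)]
    refine (norm_sum_le _ _).trans ((Finset.sum_le_sum fun i _ => hdiff i (ys i)).trans ?_)
    simp
  have hgm : ∀ i, StronglyMeasurable (g i) := fun i => by
    simp only [hg_def]
    split_ifs
    · exact hφ.sub stronglyMeasurable_const
    · exact stronglyMeasurable_const
  have hgM : ∀ i y, ‖g i y‖ ≤ 2 * C := fun i y => by
    simp only [hg_def]
    split_ifs
    · exact hdiff i y
    · simpa using hC0.le
  have hg0 : ∀ i, ∫ y, g i y ∂ν i = 0 := fun i => by
    simp only [hg_def]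
    split_ifs
    · rw [integral_sub (integrable_of_norm_le (ν i) hφ hC) (integrable_const _)]
      simp
    · simp
  have hsq : ∫ ys, f ys ^ 2 ∂Measure.pi ν ≤ A.card * C ^ 2 := by
    simp only [hfg]
    rw [integral_norm_add_sum_sq ν hgm hgM hg0]
    calc _ ≤ (0 : ℝ) + ∑ i, if i ∈ A then C ^ 2 else 0 := by
          rw [norm_zero, zero_pow two_ne_zero]
          gcongr with i
          simp only [hg_def]
          split_ifs
          · exact integral_norm_sub_integral_sq_le (ν i) hφ hC
          · simp
      _ = A.card * C ^ 2 := by simp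
  have hmean : ∫ ys, f ys ∂Measure.pi ν ≤ C * √A.card := by
    -- Nonnegative variance is Jensen's inequality: the squared mean is at most the mean square.
    have hvar := variance_nonneg f (Measure.pi ν)
    rw [variance_eq_sub (MemLp.of_bound hfm.aestronglyMeasurable _ (.of_forall hfM))] at hvar
    refine le_of_sq_le_sq ?_ (by positivity)
    rw [mul_pow, Real.sq_sqrt hcard.le]
    have : (Measure.pi ν)[f ^ 2] = ∫ ys, f ys ^ 2 ∂Measure.pi ν := rfl
    linarith
  have hbdd : ∀ i ys z, |f ys - f (Function.update ys i z)| ≤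
      if i ∈ A then √2 * C else 0 := fun i ys z => by
    simp only [hf_def]
    refine (abs_norm_sub_norm_le _ _).trans ?_
    rw [← Finset.sum_sub_distrib]
    split_ifs with hi
    · rw [Finset.sum_eq_single_of_mem i hi fun j _ hj => by simp [Function.update_of_ne hj]]
      rw [Function.update_self, sub_sub_sub_cancel_right]
      refine le_of_sq_le_sq ?_ (by positivity)
      rw [mul_pow, Real.sq_sqrt (by norm_num)]
      exact hosc _ _
    · rw [Finset.sum_eq_zero fun j hj => ?_]
      · simp
      · have hne : j ≠ i := fun h => hi (h ▸ hj)
        simp [Function.update_of_ne hne]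
  have hmc := measureReal_pi_ge_le ν hfm.measurable hfM hbdd (t := C * √A.card * √L)
    (by positivity)
  refine le_trans (measureReal_mono fun ys hys => ?_) (hmc.trans (le_of_eq ?_))
  · simp only [Set.mem_ofPred_eq] at hys ⊢
    change _ < f ys at hys
    linarith
  · congr 1
    have : ∑ i, (if i ∈ A then √2 * C else 0) ^ 2 = A.card * (2 * C ^ 2) := by
      simp [mul_pow]
    rw [this, mul_pow, mul_pow, Real.sq_sqrt hcard.le, Real.sq_sqrt hL]
    field_simp

end Variance

/-! ### The sets of nearest neighbours form a small measurable family -/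

section Candidates

open Classical in
/-- A family of sets of units, determined by the traces of a class of sets, that contains all sets
of nearest neighbours when the class consists of enough balls. -/
noncomputable def candidates {α : Type*} {n : ℕ} (𝓒 : Set (Set α)) (τ : Equiv.Perm (Fin n))
    (xs : Fin n → α) : Finset (Finset (Fin n)) :=
  (insert ∅ (traces 𝓒 xs) ×ˢ insert ∅ (traces 𝓒 xs) ×ˢ Finset.univ).image
    fun p => p.1 ∪ p.2.1.filter fun j => τ j ≤ p.2.2

lemma card_candidates_le {α : Type*} {n : ℕ} {𝓒 : Set (Set α)} {V : ℕ}
    (hV : ∀ s : Finset α, Shatters 𝓒 s → s.card ≤ V) (τ : Equiv.Perm (Fin n)) (xs : Fin n → α) :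
    (candidates 𝓒 τ xs).card ≤ ((n + 1) ^ V + 1) ^ 2 * n := by
  classical
  have h1 : (insert (∅ : Finset (Fin n)) (traces 𝓒 xs)).card ≤ (n + 1) ^ V + 1 := by
    refine (Finset.card_insert_le _ _).trans ?_
    have := card_traces_le hV xs
    rw [Fintype.card_fin] at this
    omega
  refine Finset.card_image_le.trans ?_
  rw [Finset.card_product, Finset.card_product, Finset.card_univ, Fintype.card_fin, sq, mul_assoc]
  gcongr

lemma measurableSet_mem_traces {α ι : Type*} [MeasurableSpace α] [Fintype ι] {𝓒 : Set (Set α)}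
    (hcount : 𝓒.Countable) (hmeas : ∀ B ∈ 𝓒, MeasurableSet B) (A : Finset ι) :
    MeasurableSet {xs : ι → α | A ∈ traces 𝓒 xs} := by
  classical
  have h : {xs : ι → α | A ∈ traces 𝓒 xs} = ⋃ B ∈ 𝓒, ⋂ i, {xs | i ∈ A ↔ xs i ∈ B} := by
    ext xs
    simp [traces, Finset.ext_iff]
  rw [h]
  refine MeasurableSet.biUnion hcount fun B hB => MeasurableSet.iInter fun i => ?_
  have hm : MeasurableSet {xs : ι → α | xs i ∈ B} := (measurable_pi_apply i) (hmeas B hB)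
  exact (MeasurableSet.const (i ∈ A)).iff hm

lemma measurableSet_mem_candidates {α : Type*} [MeasurableSpace α] {n : ℕ} {𝓒 : Set (Set α)}
    (hcount : 𝓒.Countable) (hmeas : ∀ B ∈ 𝓒, MeasurableSet B) (τ : Equiv.Perm (Fin n))
    (A : Finset (Fin n)) : MeasurableSet {xs : Fin n → α | A ∈ candidates 𝓒 τ xs} := by
  classical
  have h : {xs : Fin n → α | A ∈ candidates 𝓒 τ xs} =
      ⋃ p : Finset (Fin n) × Finset (Fin n) × Fin n,
        {xs | (p.1 = ∅ ∨ p.1 ∈ traces 𝓒 xs) ∧ (p.2.1 = ∅ ∨ p.2.1 ∈ traces 𝓒 xs) ∧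
          p.1 ∪ p.2.1.filter (fun j => τ j ≤ p.2.2) = A} := by
    ext xs
    simp [candidates, and_assoc]
  rw [h]
  refine MeasurableSet.iUnion fun p => ?_
  have hT : ∀ T : Finset (Fin n), MeasurableSet {xs : Fin n → α | T = ∅ ∨ T ∈ traces 𝓒 xs} :=
    fun T => (MeasurableSet.const (T = ∅)).union (measurableSet_mem_traces hcount hmeas T)
  exact (hT p.1).inter ((hT p.2.1).inter (MeasurableSet.const _))

/-- With high probability the sums over all sets in the candidate family deviate little from their
conditional means. -/
lemma pi_exists_candidates_lt_norm_sum_le {𝒳 𝒴 H : Type*} [MeasurableSpace 𝒳] [MeasurableSpace 𝒴]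
    [NormedAddCommGroup H] [InnerProductSpace ℝ H] [CompleteSpace H]
    (P : Measure 𝒳) [IsProbabilityMeasure P] (κ : Kernel 𝒳 𝒴) [IsMarkovKernel κ]
    {φ : 𝒴 → H} (hφ : StronglyMeasurable φ) {C : ℝ}
    (hC0 : 0 < C) (hC : ∀ y, ‖φ y‖ ≤ C) (hosc : ∀ y y', ‖φ y - φ y'‖ ^ 2 ≤ 2 * C ^ 2)
    {𝓒 : Set (Set 𝒳)} (hcount : 𝓒.Countable) (hmeas : ∀ B ∈ 𝓒, MeasurableSet B) {V : ℕ}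
    (hV : ∀ s : Finset 𝒳, Shatters 𝓒 s → s.card ≤ V) {n : ℕ} (τ : Equiv.Perm (Fin n))
    {L : ℝ} (hL : 0 ≤ L) :
    MeasurableSet {z : Fin n → 𝒳 × 𝒴 | ∃ A ∈ candidates 𝓒 τ (fun i => (z i).1),
      C * √A.card * (1 + √L) < ‖∑ j ∈ A, (φ (z j).2 - ∫ y, φ y ∂κ (z j).1)‖} ∧
    (Measure.pi fun _ : Fin n => P ⊗ₘ κ)
      {z | ∃ A ∈ candidates 𝓒 τ (fun i => (z i).1),
        C * √A.card * (1 + √L) < ‖∑ j ∈ A, (φ (z j).2 - ∫ y, φ y ∂κ (z j).1)‖} ≤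
      ENNReal.ofReal (((n + 1) ^ V + 1) ^ 2 * n * Real.exp (-L)) := by
  set G : Set (Fin n → 𝒳 × 𝒴) := {z | ∃ A ∈ candidates 𝓒 τ (fun i => (z i).1),
      C * √A.card * (1 + √L) < ‖∑ j ∈ A, (φ (z j).2 - ∫ y, φ y ∂κ (z j).1)‖} with hG_def
  have hmean : StronglyMeasurable fun x => ∫ y, φ y ∂κ x := hφ.integral_kernel
  have hG : MeasurableSet G := by
    have h : G = ⋃ A : Finset (Fin n), {z | A ∈ candidates 𝓒 τ (fun i => (z i).1)} ∩
        {z | C * √A.card * (1 + √L) < ‖∑ j ∈ A, (φ (z j).2 - ∫ y, φ y ∂κ (z j).1)‖} := by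
      ext z
      simp [hG_def]
    rw [h]
    refine MeasurableSet.iUnion fun A => MeasurableSet.inter ?_ ?_
    · have hm : Measurable fun (z : Fin n → 𝒳 × 𝒴) i => (z i).1 := by fun_prop
      exact hm (measurableSet_mem_candidates hcount hmeas τ A)
    · refine measurableSet_lt measurable_const (StronglyMeasurable.measurable ?_)
      refine (Finset.stronglyMeasurable_fun_sum _ fun j _ => ?_).norm
      exact (hφ.comp_measurable (measurable_snd.comp (measurable_pi_apply j))).sub
        (hmean.comp_measurable (measurable_fst.comp (measurable_pi_apply j)))
  refine ⟨hG, pi_compProd_le P κ hG fun xs => ?_⟩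
  have hsub : {ys : Fin n → 𝒴 | (fun i => (xs i, ys i)) ∈ G} ⊆ ⋃ A ∈ candidates 𝓒 τ xs,
      {ys | C * √A.card * (1 + √L) < ‖∑ j ∈ A, (φ (ys j) - ∫ y, φ y ∂κ (xs j))‖} := by
    rintro ys ⟨A, hA, h⟩
    exact Set.mem_biUnion hA h
  calc _ ≤ ∑ A ∈ candidates 𝓒 τ xs, Measure.pi (fun i => κ (xs i))
        {ys | C * √A.card * (1 + √L) < ‖∑ j ∈ A, (φ (ys j) - ∫ y, φ y ∂κ (xs j))‖} :=
      (measure_mono hsub).trans (measure_biUnion_finset_le _ _)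
    _ ≤ ∑ _A ∈ candidates 𝓒 τ xs, ENNReal.ofReal (Real.exp (-L)) := by
      refine Finset.sum_le_sum fun A _ => ?_
      rw [← ofReal_measureReal]
      exact ENNReal.ofReal_le_ofReal
        (measureReal_pi_lt_norm_sum_le (fun i => κ (xs i)) hφ hC0 hC hosc A hL)
    _ = ENNReal.ofReal ((candidates 𝓒 τ xs).card * Real.exp (-L)) := by
      rw [Finset.sum_const, nsmul_eq_mul, ENNReal.ofReal_mul (Nat.cast_nonneg _),
        ENNReal.ofReal_natCast]
    _ ≤ _ := by
      refine ENNReal.ofReal_le_ofReal (mul_le_mul_of_nonneg_right ?_ (Real.exp_pos _).le)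
      exact_mod_cast card_candidates_le hV τ xs

end Candidates

/-! ### A countable class of balls -/

section Balls

variable {𝒳 : Type*} [MetricSpace 𝒳]

/-- The points all of whose balls have positive measure form a separable set. -/
lemma exists_countable_subset_closure [MeasurableSpace 𝒳] [OpensMeasurableSpace 𝒳]
    (P : Measure 𝒳) [IsFiniteMeasure P] :
    ∃ D : Set 𝒳, D.Countable ∧ {x | ∀ r : ℝ, 0 < r → 0 < P (Metric.closedBall x r)} ⊆ closure D := by
  set S := {x | ∀ r : ℝ, 0 < r → 0 < P (Metric.closedBall x r)} with hS
  suffices h : ∀ ε > 0, ∃ t : Set 𝒳, t.Countable ∧ S ⊆ ⋃ x ∈ t, Metric.closedBall x ε by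
    obtain ⟨D, -, hD, hSD⟩ := EMetric.subset_countable_closure_of_almost_dense_set S fun ε hε => by
      obtain ⟨r, hr, hrε⟩ := ENNReal.lt_iff_exists_nnreal_btwn.1 hε
      obtain ⟨t, ht, hSt⟩ := h r (by simpa using hr)
      refine ⟨t, ht, hSt.trans (Set.iUnion₂_mono fun x _ y hy => ?_)⟩
      rw [Metric.mem_closedBall, ← NNReal.coe_mk (dist y x) dist_nonneg] at hy
      change edist y x ≤ ε
      rw [edist_nndist]
      exact (ENNReal.coe_le_coe.2 hy).trans hrε.le
    exact ⟨D, hD, hSD⟩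
  intro ε hε
  -- A maximal `ε`-separated subset of `S` is an `ε`-net by maximality. It is countable because the
  -- disjoint balls of radius `ε / 2` about its points all have positive mass under a finite
  -- measure.
  obtain ⟨t, ht⟩ := zorn_subset {t : Set 𝒳 | t ⊆ S ∧ t.Pairwise fun x y => ε < dist x y} (by
    intro c hc hchain
    refine ⟨⋃₀ c, ⟨Set.sUnion_subset fun s hs => (hc hs).1, ?_⟩, fun s hs =>
      Set.subset_sUnion_of_mem hs⟩
    rw [Set.pairwise_sUnion hchain.directedOn]
    exact fun s hs => (hc hs).2)
  refine ⟨t, ?_, fun x hx => ?_⟩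
  · have hcount := Measure.countable_meas_pos_of_disjoint_iUnion (μ := P)
      (As := fun x : t => Metric.ball (x : 𝒳) (ε / 2)) (fun x => Metric.isOpen_ball.measurableSet)
      (fun x y hxy => Metric.ball_disjoint_ball (by
        have := ht.prop.2 x.2 y.2 (fun h => hxy (Subtype.ext h))
        linarith))
    have huniv : {x : t | 0 < P (Metric.ball (x : 𝒳) (ε / 2))} = Set.univ := by
      refine Set.eq_univ_of_forall fun x => ?_
      exact (ht.prop.1 x.2 (ε / 4) (by linarith)).trans_le
        (measure_mono (Metric.closedBall_subset_ball (by linarith)))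
    rw [huniv, Set.countable_univ_iff] at hcount
    exact Set.countable_coe_iff.1 hcount
  · by_contra hcon
    simp only [Set.mem_iUnion, Metric.mem_closedBall, not_exists, not_le] at hcon
    have hins : insert x t ∈ {t : Set 𝒳 | t ⊆ S ∧ t.Pairwise fun x y => ε < dist x y} := by
      refine ⟨Set.insert_subset hx ht.prop.1, ht.prop.2.insert fun y hy _ => ⟨hcon y hy, ?_⟩⟩
      rw [dist_comm]
      exact hcon y hy
    have hxt : x ∈ t := ht.le_of_ge hins (Set.subset_insert x t) (Set.mem_insert x t)
    have := hcon x hxt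
    rw [dist_self] at this
    linarith

/-- The closed balls with centre in a given set and positive rational radius. -/
def rationalBalls (D : Set 𝒳) : Set (Set 𝒳) :=
  {B | ∃ c ∈ D, ∃ q : ℚ, 0 < q ∧ B = Metric.closedBall c (q : ℝ)}

lemma countable_rationalBalls {D : Set 𝒳} (hD : D.Countable) : (rationalBalls D).Countable := by
  have h : rationalBalls D ⊆
      ⋃ c ∈ D, Set.range fun q : ℚ => Metric.closedBall c (q : ℝ) := by
    rintro _ ⟨c, hc, q, -, rfl⟩
    exact Set.mem_biUnion hc ⟨q, rfl⟩
  exact (hD.biUnion fun c _ => Set.countable_range _).mono h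

lemma measurableSet_of_mem_rationalBalls [MeasurableSpace 𝒳] [OpensMeasurableSpace 𝒳]
    {D : Set 𝒳} : ∀ B ∈ rationalBalls D, MeasurableSet B := by
  rintro _ ⟨c, -, q, -, rfl⟩
  exact Metric.isClosed_closedBall.measurableSet

lemma card_le_of_shatters_rationalBalls {D : Set 𝒳} {V : ℕ} (hV : vcDim (balls 𝒳) = (V : ℕ∞))
    (s : Finset 𝒳) (hs : Shatters (rationalBalls D) s) : s.card ≤ V := by
  have hs' : Shatters (balls 𝒳) s := fun t ht => by
    obtain ⟨_, ⟨c, -, q, hq, rfl⟩, h⟩ := hs t ht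
    exact ⟨_, ⟨c, q, by exact_mod_cast hq, rfl⟩, h⟩
  have h : (s.card : ℕ∞) ≤ vcDim (balls 𝒳) :=
    le_iSup₂ (f := fun (s : Finset 𝒳) (_ : Shatters (balls 𝒳) s) => (s.card : ℕ∞)) s hs'
  rw [hV] at h
  exact_mod_cast h

/-- A closed ball cuts out of a finite family the same points as a slightly larger ball with
rational radius whose centre lies in a dense set. -/
lemma exists_mem_rationalBalls {ι : Type*} [Finite ι] {D : Set 𝒳} {x : 𝒳} (hx : x ∈ closure D)
    {ρ : ℝ} (hρ : 0 ≤ ρ) (xs : ι → 𝒳) :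
    ∃ B ∈ rationalBalls D, Metric.closedBall x ρ ⊆ B ∧ ∀ i, xs i ∈ B ↔ dist x (xs i) ≤ ρ := by
  -- Only finitely many points are involved, so none lies at distance strictly between `ρ` and `ρ +
  -- η` for small `η`.
  have hη : ∃ η > 0, ∀ i, dist x (xs i) < ρ + η → dist x (xs i) ≤ ρ := by
    have h : ∀ i, ∀ᶠ η in nhdsWithin (0 : ℝ) (Set.Ioi 0),
        dist x (xs i) < ρ + η → dist x (xs i) ≤ ρ := fun i => by
      by_cases hi : dist x (xs i) ≤ ρ
      · exact .of_forall fun _ _ => hi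
      · have : Set.Iio (dist x (xs i) - ρ) ∈ nhds (0 : ℝ) := Iio_mem_nhds (by linarith)
        filter_upwards [mem_nhdsWithin_of_mem_nhds this] with η hη hlt
        rw [Set.mem_Iio] at hη
        linarith
    obtain ⟨η, h1, h2⟩ := ((Filter.eventually_all.2 h).and self_mem_nhdsWithin).exists
    exact ⟨η, h2, h1⟩
  obtain ⟨η, hη0, hη⟩ := hη
  obtain ⟨c, hc, hxc⟩ := Metric.mem_closure_iff.1 hx (η / 4) (by linarith)
  -- Radius above `ρ + η / 4` absorbs the shift of the centre; radius below `ρ + η / 2` keeps the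
  -- new ball within distance `ρ + 3 * η / 4` of `x`.
  obtain ⟨q, hq1, hq2⟩ := exists_rat_btwn (show ρ + η / 4 < ρ + η / 2 by linarith)
  have hq0 : (0 : ℝ) < q := by linarith
  have hsub : Metric.closedBall x ρ ⊆ Metric.closedBall c (q : ℝ) :=
    Metric.closedBall_subset_closedBall' (by linarith)
  refine ⟨_, ⟨c, hc, q, by exact_mod_cast hq0, rfl⟩, hsub, fun i => ⟨fun hi => hη i ?_, fun hi =>
    hsub (by rwa [Metric.mem_closedBall'])⟩⟩
  rw [Metric.mem_closedBall'] at hi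
  linarith [dist_triangle x c (xs i)]

open Classical in
lemma filter_dist_le_mem_traces {ι : Type*} [Fintype ι] {D : Set 𝒳} {x : 𝒳} (hx : x ∈ closure D)
    {ρ : ℝ} (hρ : 0 ≤ ρ) (xs : ι → 𝒳) :
    (Finset.univ.filter fun i => dist x (xs i) ≤ ρ) ∈ traces (rationalBalls D) xs := by
  obtain ⟨B, hB, -, h⟩ := exists_mem_rationalBalls hx hρ xs
  simp only [traces, Finset.mem_filter, Finset.mem_univ, true_and]
  exact ⟨B, hB, by simp only [h]⟩

/-- On finitely many points an open ball agrees with the closed ball whose radius is the largest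
distance attained inside it. If nothing is inside, the trace is empty, which is why `candidates`
adjoins `∅`. -/
lemma nearest_mem_candidates {n k : ℕ} {D : Set 𝒳} {x : 𝒳} (hx : x ∈ closure D)
    (xs : Fin n → 𝒳) (τ : Equiv.Perm (Fin n)) (hk1 : 1 ≤ k) (hk : k ≤ n) :
    nearest xs τ k x ∈ candidates (rationalBalls D) τ xs := by
  classical
  obtain ⟨j₀, hj₀⟩ := exists_nearest_eq xs τ x hk1 hk
  set T := Finset.univ.filter fun j => dist x (xs j) < dist x (xs j₀) with hT_def
  have hT : T ∈ insert ∅ (traces (rationalBalls D) xs) := by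
    rw [Finset.mem_insert]
    rcases T.eq_empty_or_nonempty with h | h
    · exact Or.inl h
    · right
      obtain ⟨j₁, hj₁, hmax⟩ := T.exists_max_image (fun j => dist x (xs j)) h
      have hlt : dist x (xs j₁) < dist x (xs j₀) := by simpa [hT_def] using hj₁
      have : T = Finset.univ.filter fun j => dist x (xs j) ≤ dist x (xs j₁) := by
        ext j
        simp only [Finset.mem_filter, Finset.mem_univ, true_and]
        refine ⟨fun hj => hmax j hj, fun hj => ?_⟩
        simp only [hT_def, Finset.mem_filter, Finset.mem_univ, true_and]
        exact hj.trans_lt hlt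
      rw [this]
      exact filter_dist_le_mem_traces hx dist_nonneg xs
  rw [hj₀, candidates, Finset.mem_image]
  refine ⟨(T, Finset.univ.filter fun j => dist x (xs j) ≤ dist x (xs j₀), τ j₀), ?_, ?_⟩
  · simp only [Finset.mem_product, Finset.mem_univ, and_true]
    exact ⟨hT, Finset.mem_insert_of_mem (filter_dist_le_mem_traces hx dist_nonneg xs)⟩
  · rfl

end Balls

/-! ### Mean embeddings -/

section MeanEmbedding

variable {𝒴 H : Type*} [NormedAddCommGroup H] [InnerProductSpace ℝ H] [CompleteSpace H]
  [RKHS ℝ H 𝒴 ℝ]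

lemma norm_featureMap_le {C : ℝ} (hC : 0 < C)
    (hker : ∀ y y' : 𝒴, 0 ≤ reproducingKernel H y y' ∧ reproducingKernel H y y' ≤ C ^ 2) (y : 𝒴) :
    ‖featureMap H y‖ ≤ C := by
  refine le_of_sq_le_sq ?_ hC.le
  rw [← real_inner_self_eq_norm_sq]
  exact (hker y y).2

/-- A nonnegative inner product improves the constant from `4` to `2`. This serves both the
oscillation in McDiarmid's inequality and the trivial bound for small `k`. -/
lemma norm_sub_sq_le_of_inner_nonneg {E : Type*} [NormedAddCommGroup E] [InnerProductSpace ℝ E]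
    {u v : E} {C : ℝ} (hu : ‖u‖ ≤ C) (hv : ‖v‖ ≤ C) (h : 0 ≤ ⟪u, v⟫) :
    ‖u - v‖ ^ 2 ≤ 2 * C ^ 2 := by
  rw [norm_sub_sq_real]
  nlinarith [pow_le_pow_left₀ (norm_nonneg u) hu 2, pow_le_pow_left₀ (norm_nonneg v) hv 2]

lemma norm_featureMap_sub_sq_le {C : ℝ} (hC : 0 < C)
    (hker : ∀ y y' : 𝒴, 0 ≤ reproducingKernel H y y' ∧ reproducingKernel H y y' ≤ C ^ 2)
    (y y' : 𝒴) : ‖featureMap H y - featureMap H y'‖ ^ 2 ≤ 2 * C ^ 2 :=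
  norm_sub_sq_le_of_inner_nonneg (norm_featureMap_le hC hker y) (norm_featureMap_le hC hker y')
    (hker y y').1

variable [MeasurableSpace 𝒴]

lemma meanEmbedding_knnDist {𝒳 : Type*} [MetricSpace 𝒳]
    (hΦ : StronglyMeasurable (featureMap H : 𝒴 → H)) {n : ℕ} (xs : Fin n → 𝒳) (ys : Fin n → 𝒴)
    (τ : Equiv.Perm (Fin n)) (k : ℕ) (x : 𝒳) :
    meanEmbedding H (knnDist xs ys τ k x) =
      (k : ℝ)⁻¹ • ∑ j ∈ nearest xs τ k x, featureMap H (ys j) := by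
  -- Singletons of `𝒴` need not be measurable, so integration against a Dirac mass rests on strong
  -- measurability of the feature map.
  rw [meanEmbedding, knnDist, integral_smul_measure, integral_finsetSum_measure fun j _ =>
    integrable_dirac' hΦ enorm_lt_top]
  simp only [integral_dirac' _ _ hΦ, ENNReal.toReal_inv, ENNReal.toReal_natCast]

/-- The squared distance of the mean embedding of a probability measure to that of an empirical
measure is bounded. -/
lemma norm_meanEmbedding_sub_sq_le (hΦ : StronglyMeasurable (featureMap H : 𝒴 → H)) {C : ℝ}
    (hC : 0 < C)
    (hker : ∀ y y' : 𝒴, 0 ≤ reproducingKernel H y y' ∧ reproducingKernel H y y' ≤ C ^ 2)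
    (Q : Measure 𝒴) [IsProbabilityMeasure Q] {ι : Type*} (A : Finset ι) (hA : 0 < A.card)
    (ys : ι → 𝒴) :
    ‖meanEmbedding H Q - (A.card : ℝ)⁻¹ • ∑ j ∈ A, featureMap H (ys j)‖ ^ 2 ≤ 2 * C ^ 2 := by
  have hΦC := norm_featureMap_le hC hker
  have hcard : (0 : ℝ) < A.card := by exact_mod_cast hA
  refine norm_sub_sq_le_of_inner_nonneg (norm_integral_le_of_norm_le Q hΦC) ?_ ?_
  · rw [norm_smul, norm_inv, Real.norm_of_nonneg hcard.le, inv_mul_le_iff₀ hcard]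
    refine (norm_sum_le _ _).trans ((Finset.sum_le_sum fun j _ => hΦC (ys j)).trans ?_)
    simp
  · rw [inner_smul_right, inner_sum]
    refine mul_nonneg (by positivity) (Finset.sum_nonneg fun j _ => ?_)
    rw [real_inner_comm, meanEmbedding, ← integral_inner (integrable_of_norm_le Q hΦ hΦC)]
    exact integral_nonneg fun y => (hker (ys j) y).1

end MeanEmbedding

/-- The bias–variance decomposition of an average. -/
lemma norm_sub_average_sq_le {E ι : Type*} [NormedAddCommGroup E] [InnerProductSpace ℝ E]
    (A : Finset ι) (hA : 0 < A.card) (u : E) (v w : ι → E) {b C M : ℝ} (hM : 0 ≤ M)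
    (hb : ∀ j ∈ A, ‖u - v j‖ ≤ b)
    (hvar : ‖∑ j ∈ A, (w j - v j)‖ ≤ C * √A.card * (1 + √M)) :
    ‖u - (A.card : ℝ)⁻¹ • ∑ j ∈ A, w j‖ ^ 2 ≤
      4 * C ^ 2 * (1 + M) * (1 / A.card) + 2 * b ^ 2 := by
  have hcard : (0 : ℝ) < A.card := by exact_mod_cast hA
  have hdecomp : u - (A.card : ℝ)⁻¹ • ∑ j ∈ A, w j =
      (A.card : ℝ)⁻¹ • ∑ j ∈ A, (u - v j) - (A.card : ℝ)⁻¹ • ∑ j ∈ A, (w j - v j) := by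
    rw [← smul_sub, ← Finset.sum_sub_distrib]
    simp only [sub_sub_sub_cancel_right]
    rw [Finset.sum_sub_distrib, Finset.sum_const, smul_sub, ← Nat.cast_smul_eq_nsmul ℝ, smul_smul,
      inv_mul_cancel₀ hcard.ne', one_smul]
  have h1 : ‖(A.card : ℝ)⁻¹ • ∑ j ∈ A, (u - v j)‖ ≤ b := by
    rw [norm_smul, norm_inv, Real.norm_of_nonneg hcard.le, inv_mul_le_iff₀ hcard]
    refine (norm_sum_le _ _).trans ((Finset.sum_le_sum hb).trans ?_)
    simp
  have h2 : ‖(A.card : ℝ)⁻¹ • ∑ j ∈ A, (w j - v j)‖ ^ 2 ≤ 2 * C ^ 2 * (1 + M) * (1 / A.card) := by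
    rw [norm_smul, norm_inv, Real.norm_of_nonneg hcard.le, mul_pow]
    calc ((A.card : ℝ)⁻¹) ^ 2 * ‖∑ j ∈ A, (w j - v j)‖ ^ 2
        ≤ ((A.card : ℝ)⁻¹) ^ 2 * (C * √A.card * (1 + √M)) ^ 2 := by gcongr
      _ = C ^ 2 * (1 / A.card) * (1 + √M) ^ 2 := by
        rw [mul_pow, mul_pow, Real.sq_sqrt hcard.le]
        field_simp
      -- The inequality `(1 + √M) ^ 2 ≤ 2 * (1 + M)`; a second factor `2` comes from separating bias
      -- and variance, hence the constant `4`.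
      _ ≤ C ^ 2 * (1 / A.card) * (2 * (1 + M)) := by
        gcongr
        nlinarith [Real.sq_sqrt hM, sq_nonneg (1 - √M)]
      _ = _ := by ring
  rw [hdecomp]
  set p := (A.card : ℝ)⁻¹ • ∑ j ∈ A, (u - v j)
  set q := (A.card : ℝ)⁻¹ • ∑ j ∈ A, (w j - v j)
  have h3 : ‖p - q‖ ^ 2 ≤ 2 * ‖p‖ ^ 2 + 2 * ‖q‖ ^ 2 := by
    nlinarith [norm_sub_le p q, norm_nonneg (p - q), sq_nonneg (‖p‖ - ‖q‖), norm_nonneg p,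
      norm_nonneg q]
  have h4 : ‖p‖ ^ 2 ≤ b ^ 2 := pow_le_pow_left₀ (norm_nonneg _) h1 2
  linarith

/-! ### Numerical estimates -/

section Numerics

/-- Bootstrapping with `k ≤ n` and `k > 2 + 8 ln n`: `n ≥ 2` gives `k ≥ 8`, then `n ≥ 8` gives `k >
18`, and `n ≥ 16` gives `k > 24`. -/
lemma twentyFive_le {n k V : ℕ} (hV : 0 < V) {δ : ℝ} (hδ0 : 0 < δ) (hδ1 : δ < 1) (hkn : k ≤ n)
    (hk : 2 + 8 * (V * Real.log n - Real.log δ) < k) : 25 ≤ k := by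
  have hV1 : (1 : ℝ) ≤ V := by exact_mod_cast hV
  have hδ : Real.log δ < 0 := Real.log_neg hδ0 hδ1
  have hkn' : (k : ℝ) ≤ n := by exact_mod_cast hkn
  have hn0 : 0 ≤ Real.log n := Real.log_natCast_nonneg n
  have hlog : 2 + 8 * Real.log n < k := by nlinarith
  have hstep : ∀ m : ℕ, (2 : ℝ) ^ m ≤ n → 2 + 8 * (m * 0.693) < (k : ℝ) := fun m hm => by
    have h1 := Real.log_le_log (by positivity) hm
    rw [Real.log_pow] at h1
    have h2 := Real.log_two_gt_d9
    have h3 : (m : ℝ) * 0.693 ≤ m * Real.log 2 := by gcongr; linarith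
    linarith
  have h1 := hstep 1 (by linarith)
  have h3 := hstep 3 (by
    have : (7 : ℝ) < k := by norm_num at h1; linarith
    have : (8 : ℝ) ≤ k := by exact_mod_cast (by exact_mod_cast this : 7 < k)
    linarith)
  have h4 := hstep 4 (by norm_num at h3; linarith)
  have : (24 : ℝ) < k := by norm_num at h4; linarith
  exact_mod_cast this

lemma exp_neg_eq {n V : ℕ} (hn : 0 < n) {δ : ℝ} (hδ0 : 0 < δ) (m : ℕ) :
    Real.exp (-(m * (V * Real.log n - Real.log δ))) = (δ / n ^ V) ^ m := by
  have hn' : (0 : ℝ) < n := by exact_mod_cast hn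
  rw [show -((m : ℝ) * (V * Real.log n - Real.log δ)) = m * (Real.log δ - V * Real.log n) by ring,
    Real.exp_nat_mul, Real.exp_sub, Real.exp_log hδ0, Real.exp_nat_mul, Real.exp_log hn']

/-- The number of candidates is at most `n ^ (4 * V)`, which the factor `exp (-4 L) = (δ / n ^ V) ^
4` cancels, leaving `δ ^ 4`. -/
lemma card_candidates_mul_exp_le {n V : ℕ} (hn : 25 ≤ n) (hV : 0 < V) {δ : ℝ} (hδ0 : 0 < δ)
    (hδ1 : δ < 1) :
    ((n + 1) ^ V + 1) ^ 2 * n * Real.exp (-(4 * (V * Real.log n - Real.log δ))) ≤ δ := by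
  have hn' : (25 : ℝ) ≤ n := by exact_mod_cast hn
  have h1 : ((n : ℝ) + 1) ^ V + 1 ≤ (n + 2) ^ V := by
    have : (n + 1) ^ V + 1 ≤ (n + 2) ^ V := Nat.pow_lt_pow_left (by omega) hV.ne'
    exact_mod_cast this
  have h2 : ((n : ℝ) + 2) ^ 2 * n ≤ n ^ 4 := by
    have : ((n : ℝ) + 2) ^ 2 ≤ n ^ 3 := by nlinarith [sq_nonneg (n : ℝ)]
    calc _ ≤ (n : ℝ) ^ 3 * n := by gcongr
      _ = _ := by ring
  have h3 : (n : ℝ) ≤ n ^ V := le_self_pow₀ (by linarith) hV.ne'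
  have h4 : (((n : ℝ) + 1) ^ V + 1) ^ 2 * n ≤ (n ^ V) ^ 4 := by
    calc _ ≤ (((n : ℝ) + 2) ^ V) ^ 2 * n ^ V := by gcongr
      _ = (((n : ℝ) + 2) ^ 2 * n) ^ V := by rw [mul_pow, ← pow_mul, ← pow_mul, mul_comm V]
      _ ≤ ((n : ℝ) ^ 4) ^ V := by gcongr
      _ = _ := by rw [← pow_mul, ← pow_mul, mul_comm]
  have h5 := exp_neg_eq (V := V) (show 0 < n by omega) hδ0 4
  push_cast at h5
  rw [h5, div_pow]
  calc _ ≤ ((n : ℝ) ^ V) ^ 4 * (δ ^ 4 / (n ^ V) ^ 4) := by gcongr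
    _ = δ ^ 4 := by field_simp
    _ ≤ δ := pow_le_of_le_one hδ0.le hδ1.le (by norm_num)

/-- The leading factor `n` pays for the union over `k`. After squaring, the base `q = 25 / 14 * (5 /
6) ^ 5` satisfies `q ^ 2 ≤ exp (-5 / 8)`, so `k > 8 L` gives `q ^ (2 * k) ≤ exp (-5 L) = (δ / n ^ V)
^ 5`. This absorbs the polynomial factors once `n ≥ 25`. -/
lemma ghost_bound_le {n k V : ℕ} (hn : 25 ≤ n) (hV : 0 < V) {δ : ℝ} (hδ0 : 0 < δ) (hδ1 : δ < 1)
    (hk : 2 + 8 * (V * Real.log n - Real.log δ) < k) :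
    n * (2 * ((2 * n + 1) ^ V * (25 / 14 * (5 / 6 : ℝ) ^ 5) ^ k)) ≤ δ := by
  have hn' : (25 : ℝ) ≤ n := by exact_mod_cast hn
  set L := V * Real.log n - Real.log δ with hL
  have hexp : Real.exp (5 / 8) ≤ 19 / 10 := by
    refine le_of_pow_le_pow_left₀ (n := 8) (by norm_num) (by norm_num) ?_
    rw [← Real.exp_nat_mul, show ((8 : ℕ) : ℝ) * (5 / 8) = (5 : ℕ) * 1 by norm_num,
      Real.exp_nat_mul]
    calc Real.exp 1 ^ 5 ≤ 2.72 ^ 5 := by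
          gcongr
          linarith [Real.exp_one_lt_d9]
      _ ≤ _ := by norm_num
  have hq : (25 / 14 * (5 / 6 : ℝ) ^ 5) ^ 2 ≤ Real.exp (-(5 / 8)) := by
    rw [Real.exp_neg, le_inv_comm₀ (by positivity) (Real.exp_pos _)]
    exact hexp.trans (by norm_num)
  have hqk : ((25 / 14 * (5 / 6 : ℝ) ^ 5) ^ k) ^ 2 ≤ (δ / n ^ V) ^ 5 := by
    have h5 := exp_neg_eq (V := V) (show 0 < n by omega) hδ0 5
    push_cast at h5
    rw [← h5, ← hL, ← pow_mul, mul_comm k, pow_mul]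
    calc _ ≤ Real.exp (-(5 / 8)) ^ k := by gcongr
      _ = Real.exp (k * -(5 / 8)) := (Real.exp_nat_mul _ _).symm
      _ ≤ _ := Real.exp_le_exp.2 (by linarith)
  have hpoly : 4 * (n : ℝ) ^ 2 * (2 * n + 1) ^ 2 ≤ n ^ 5 := by
    have : 4 * (2 * (n : ℝ) + 1) ^ 2 ≤ n ^ 3 := by nlinarith [sq_nonneg (n : ℝ)]
    calc _ = (n : ℝ) ^ 2 * (4 * (2 * n + 1) ^ 2) := by ring
      _ ≤ n ^ 2 * n ^ 3 := by gcongr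
      _ = _ := by ring
  have hpolyV : 4 * (n : ℝ) ^ 2 * ((2 * n + 1) ^ V) ^ 2 ≤ (n ^ V) ^ 5 := by
    have h1 : 4 * (n : ℝ) ^ 2 ≤ (4 * n ^ 2) ^ V := le_self_pow₀ (by nlinarith) hV.ne'
    calc _ ≤ (4 * (n : ℝ) ^ 2) ^ V * ((2 * n + 1) ^ V) ^ 2 := by gcongr
      _ = (4 * (n : ℝ) ^ 2 * (2 * n + 1) ^ 2) ^ V := by
        rw [mul_pow (4 * (n : ℝ) ^ 2), ← pow_mul, ← pow_mul, mul_comm V]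
      _ ≤ ((n : ℝ) ^ 5) ^ V := by gcongr
      _ = _ := by rw [← pow_mul, ← pow_mul, mul_comm]
  refine le_of_sq_le_sq ?_ hδ0.le
  calc _ = 4 * (n : ℝ) ^ 2 * ((2 * n + 1) ^ V) ^ 2 * ((25 / 14 * (5 / 6 : ℝ) ^ 5) ^ k) ^ 2 := by
        ring
    _ ≤ (n ^ V) ^ 5 * (δ / n ^ V) ^ 5 := by gcongr
    _ = δ ^ 5 := by
        rw [← mul_pow]
        congr 1
        field_simp
    _ ≤ δ ^ 2 := pow_le_pow_of_le_one hδ0.le hδ1.le (by norm_num)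

end Numerics

/-! ### The favourable event and the theorem -/

/-- If all small balls around `x` are controlled by doubling and one ball has positive measure,
then all balls around `x` have positive measure. -/
lemma measure_closedBall_pos_of_doubling {𝒳 : Type*} [MetricSpace 𝒳] [MeasurableSpace 𝒳]
    (P : Measure 𝒳) [IsProbabilityMeasure P] {x : 𝒳} {r C d : ℝ}
    (hpos : 0 < P.real (Metric.closedBall x r)) (hr : 0 < r) (hC : 0 < C)
    (h : ∀ ε : ℝ, 0 < ε → ε < 1 →
      P.real (Metric.closedBall x r) ≤ C * ε ^ (-d) * P.real (Metric.closedBall x (ε * r)))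
    {s : ℝ} (hs : 0 < s) : 0 < P (Metric.closedBall x s) := by
  suffices hreal : 0 < P.real (Metric.closedBall x s) from
    (ENNReal.toReal_pos_iff.1 hreal).1
  rcases le_or_gt r s with hrs | hsr
  · exact hpos.trans_le (measureReal_mono (Metric.closedBall_subset_closedBall hrs))
  · have h1 := h (s / r) (by positivity) ((div_lt_one hr).2 hsr)
    rw [div_mul_cancel₀ _ hr.ne'] at h1
    have h2 : 0 < C * (s / r) ^ (-d) := by positivity
    exact pos_of_mul_pos_right (hpos.trans_le h1) h2.le

/-- An event that depends on an independent choice among finitely many events of small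
probability has small probability. -/
lemma measure_iUnion_preimage_inter_le {Ω σ ζ : Type*} [MeasurableSpace Ω] {μ : Measure Ω}
    [IsProbabilityMeasure μ] [Fintype σ] [MeasurableSpace σ] [MeasurableSingletonClass σ]
    [MeasurableSpace ζ] {τ : Ω → σ} (hτ : Measurable τ) {Z : Ω → ζ} (h : IndepFun τ Z μ)
    {G : σ → Set ζ} (hG : ∀ s, MeasurableSet (G s)) {c : ℝ≥0∞} (hc : ∀ s, μ (Z ⁻¹' G s) ≤ c) :
    μ (⋃ s, τ ⁻¹' {s} ∩ Z ⁻¹' G s) ≤ c := by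
  classical
  calc _ ≤ ∑ s, μ (τ ⁻¹' {s} ∩ Z ⁻¹' G s) := measure_iUnion_fintype_le _ _
    _ ≤ ∑ s, μ (τ ⁻¹' {s}) * c := by
      refine Finset.sum_le_sum fun s _ => ?_
      rw [h.measure_inter_preimage_eq_mul _ _ (measurableSet_singleton s) (hG s)]
      gcongr
      exact hc s
    _ = c := by
      rw [← Finset.sum_mul, sum_measure_preimage_singleton _ fun s _ =>
        hτ (measurableSet_singleton s)]
      simp

/-- With high probability, for all large `k` at once, every member of a countable
Vapnik–Chervonenkis class that has probability at least `3 k / n` contains at least `k` of the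
covariates. -/
lemma pi_exists_pointCount_lt_le {𝒳 𝒴 : Type*} [MeasurableSpace 𝒳] [MeasurableSpace 𝒴]
    (P : Measure 𝒳) [IsProbabilityMeasure P] (κ : Kernel 𝒳 𝒴) [IsMarkovKernel κ]
    {𝓒 : Set (Set 𝒳)} (hcount : 𝓒.Countable) (hmeas : ∀ B ∈ 𝓒, MeasurableSet B) {V : ℕ}
    (hV : ∀ s : Finset 𝒳, Shatters 𝓒 s → s.card ≤ V) (hV0 : 0 < V) {n : ℕ} (hn : 25 ≤ n) {δ : ℝ}
    (hδ0 : 0 < δ) (hδ1 : δ < 1) :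
    (Measure.pi fun _ : Fin n => P ⊗ₘ κ)
      (⋃ k ∈ (Finset.Icc 1 n).filter fun k : ℕ => 2 + 8 * (V * Real.log n - Real.log δ) < k,
        {z | ∃ B ∈ 𝓒, 3 * (k : ℝ) ≤ n * P.real B ∧ pointCount B (fun i => (z i).1) < k}) ≤
      ENNReal.ofReal δ := by
  have hmp : MeasurePreserving (fun (z : Fin n → 𝒳 × 𝒴) i => (z i).1)
      (Measure.pi fun _ : Fin n => P ⊗ₘ κ) (Measure.pi fun _ : Fin n => P) :=
    measurePreserving_pi (fun _ : Fin n => P ⊗ₘ κ) (fun _ => P) (f := fun _ => Prod.fst)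
      fun _ => ⟨measurable_fst, Measure.fst_compProd P κ⟩
  refine (measure_biUnion_finset_le _ _).trans ?_
  have hn' : (0 : ℝ) < n := by exact_mod_cast (by omega : 0 < n)
  calc _ ≤ ∑ k ∈ (Finset.Icc 1 n).filter fun k : ℕ => 2 + 8 * (V * Real.log n - Real.log δ) < k,
        ENNReal.ofReal (δ / n) := by
        refine Finset.sum_le_sum fun k hk => ?_
        rw [Finset.mem_filter, Finset.mem_Icc] at hk
        obtain ⟨⟨-, hkn⟩, hk⟩ := hk
        have hk25 := twentyFive_le hV0 hδ0 hδ1 hkn hk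
        obtain ⟨hA, hle⟩ := measureReal_pi_exists_pointCount_lt_le P hcount hmeas hV (n := n)
          (k := k) (by omega)
        have h1 := hmp.measure_preimage hA.nullMeasurableSet
        change (Measure.pi fun _ : Fin n => P ⊗ₘ κ) {z | ∃ B ∈ 𝓒, 3 * (k : ℝ) ≤ n * P.real B ∧
          pointCount B (fun i => (z i).1) < k} = _ at h1
        rw [h1, ← ofReal_measureReal]
        refine ENNReal.ofReal_le_ofReal (hle.trans ?_)
        rw [le_div_iff₀' hn']
        exact ghost_bound_le hn hV0 hδ0 hδ1 hk
    _ ≤ (n : ℝ≥0∞) * ENNReal.ofReal (δ / n) := by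
        rw [Finset.sum_const, nsmul_eq_mul]
        gcongr
        exact (Finset.card_filter_le _ _).trans (by simp)
    _ = ENNReal.ofReal δ := by
        rw [← ENNReal.ofReal_natCast, ← ENNReal.ofReal_mul hn'.le, mul_div_cancel₀ _ hn'.ne']

/-- The radius at which doubling guarantees mass `3 k / n`. -/
lemma exists_scale {a n k C d : ℝ} (ha : 0 < a) (hn : 0 < n) (hk : 0 < k) (hC : 0 < C) (hd : 0 < d)
    (h : k / n < a / (3 * C)) :
    ∃ ε : ℝ, 0 < ε ∧ ε < 1 ∧ ε ^ 2 = (3 * C / a * (k / n)) ^ (2 / d) ∧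
      ∀ b, a ≤ C * ε ^ (-d) * b → 3 * k ≤ n * b := by
  set q := 3 * C / a * (k / n) with hq
  have hq0 : 0 < q := by positivity
  have hq1 : q < 1 := by
    rw [lt_div_iff₀ (by positivity)] at h
    rw [hq, div_mul_eq_mul_div, div_lt_one ha]
    linarith
  -- The choice `ε ^ d = q` makes `C * ε ^ (-d) * b` equal to `a * n * b / (3 * k)`.
  refine ⟨q ^ (1 / d), by positivity, Real.rpow_lt_one hq0.le hq1 (by positivity), ?_,
    fun b hb => ?_⟩
  · rw [← Real.rpow_natCast, ← Real.rpow_mul hq0.le]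
    congr 1
    push_cast
    ring
  · rw [← Real.rpow_mul hq0.le, show 1 / d * -d = -1 by field_simp, Real.rpow_neg_one] at hb
    have h1 : C * q⁻¹ * b = a * (n * b) / (3 * k) := by
      rw [hq]
      field_simp
    rw [h1, le_div_iff₀ (by positivity)] at hb
    exact le_of_mul_le_mul_left hb ha

end KNN

theorem theorem1
    {𝒳 𝒴 H Ω : Type*}
    [MetricSpace 𝒳] [MeasurableSpace 𝒳] [OpensMeasurableSpace 𝒳]
    [MeasurableSpace 𝒴]
    [NormedAddCommGroup H] [InnerProductSpace ℝ H] [CompleteSpace H] [RKHS ℝ H 𝒴 ℝ]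
    [MeasurableSpace Ω] (μ : Measure Ω) [IsProbabilityMeasure μ]
    -- the covariate distribution `P(x)` and the conditional distribution `P(y|x)`
    (P : Measure 𝒳) [IsProbabilityMeasure P]
    (κ : Kernel 𝒳 𝒴) [IsMarkovKernel κ]
    -- the i.i.d. sample
    (n : ℕ) (X : Fin n → Ω → 𝒳) (Y : Fin n → Ω → 𝒴)
    (hlaw : ∀ i, HasLaw (fun ω => (X i ω, Y i ω)) (P ⊗ₘ κ) μ)
    (hindep : iIndepFun (fun i ω => (X i ω, Y i ω)) μ)
    -- the ranking of the units that breaks ties, random and independent of the sample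
    (τ : Ω → Equiv.Perm (Fin n)) (hτ : Measurable τ)
    (hτindep : IndepFun τ (fun ω i => (X i ω, Y i ω)) μ)
    -- mean embeddings are defined
    (hΦ : StronglyMeasurable (KNN.featureMap H : 𝒴 → H))
    -- the conditional mean embedding is Lipschitz
    (lam : ℝ) (hlam : 0 < lam)
    (hLip : ∀ x x' : 𝒳,
      ‖KNN.meanEmbedding H (κ x) - KNN.meanEmbedding H (κ x')‖ ≤ lam * dist x x')
    -- the kernel is bounded
    (Cker : ℝ) (hCker : 0 < Cker)
    (hker : ∀ y y' : 𝒴, 0 ≤ KNN.reproducingKernel H y y' ∧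
      KNN.reproducingKernel H y y' ≤ Cker ^ 2)
    -- the covariate distribution has intrinsic dimension `d`
    (Cdist rmax d : ℝ) (hCdist : 0 < Cdist) (hrmax : 0 < rmax) (hd : 0 < d)
    (hdoubling : ∀ (x : 𝒳) (r ε : ℝ), 0 < r → r < rmax → 0 < ε → ε < 1 →
      P.real (Metric.closedBall x r) ≤ Cdist * ε ^ (-d) * P.real (Metric.closedBall x (ε * r)))
    -- the class of balls has finite positive VC dimension `V`
    (V : ℕ) (hVpos : 0 < V) (hV : KNN.vcDim (KNN.balls 𝒳) = (V : ℕ∞))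
    (δ : ℝ) (hδ0 : 0 < δ) (hδ1 : δ < 1) :
    ∃ E : Set Ω, MeasurableSet E ∧ 1 - 2 * δ ≤ μ.real E ∧
      ∀ ω ∈ E, ∀ (x : 𝒳) (k : ℕ) (r : ℝ), 1 ≤ k → k ≤ n → 0 < r → r < rmax →
        V * Real.log (2 * n) + Real.log (8 / δ) ≤ k →
        (k : ℝ) / n < P.real (Metric.closedBall x r) / (3 * Cdist) →
        ‖KNN.meanEmbedding H (κ x) -
            KNN.meanEmbedding H
              (KNN.knnDist (fun i => X i ω) (fun i => Y i ω) (τ ω) k x)‖ ^ 2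
          ≤ 4 * Cker ^ 2 * (1 + 4 * (V * Real.log n - Real.log δ)) * (1 / k)
            + 2 * lam ^ 2 * r ^ 2 *
              (3 * Cdist / P.real (Metric.closedBall x r) * (k / n)) ^ (2 / d) := by
  set L := V * Real.log n - Real.log δ with hL
  have hL0 : 0 ≤ L := by
    have h1 := Real.log_neg hδ0 hδ1
    have h2 : 0 ≤ V * Real.log n := mul_nonneg (Nat.cast_nonneg _) (Real.log_natCast_nonneg n)
    linarith
  have hΦC := KNN.norm_featureMap_le (H := H) hCker hker
  -- for small `k` the bound holds because the left-hand side is at most `2 * Cker ^ 2`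
  have htrivial : ∀ ω (x : 𝒳) (k : ℕ) (r : ℝ), 1 ≤ k → k ≤ n → (k : ℝ) ≤ 2 + 8 * L →
      ‖KNN.meanEmbedding H (κ x) - KNN.meanEmbedding H
          (KNN.knnDist (fun i => X i ω) (fun i => Y i ω) (τ ω) k x)‖ ^ 2
        ≤ 4 * Cker ^ 2 * (1 + 4 * L) * (1 / k) + 2 * lam ^ 2 * r ^ 2 *
          (3 * Cdist / P.real (Metric.closedBall x r) * (k / n)) ^ (2 / d) := by
    intro ω x k r hk1 hkn hk
    have hk0 : (0 : ℝ) < k := by exact_mod_cast hk1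
    have hcard := KNN.card_nearest (fun i => X i ω) (τ ω) x hkn
    have h1 := KNN.norm_meanEmbedding_sub_sq_le hΦ hCker hker (κ x)
      (KNN.nearest (fun i => X i ω) (τ ω) k x) (by omega) (fun i => Y i ω)
    rw [hcard] at h1
    rw [KNN.meanEmbedding_knnDist hΦ]
    have h2 : 2 * Cker ^ 2 ≤ 4 * Cker ^ 2 * (1 + 4 * L) * (1 / k) := by
      rw [mul_one_div, le_div_iff₀ hk0]
      nlinarith [sq_nonneg Cker]
    have h3 : 0 ≤ 2 * lam ^ 2 * r ^ 2 *
        (3 * Cdist / P.real (Metric.closedBall x r) * (k / n)) ^ (2 / d) := by positivity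
    linarith
  by_cases hn : 25 ≤ n
  swap
  -- For `n < 25` every `k ≤ n` falls under the trivial bound, so no event has to be excluded.
  · refine ⟨Set.univ, MeasurableSet.univ, by simp [hδ0.le], ?_⟩
    intro ω _ x k r hk1 hkn _ _ _ _
    refine htrivial ω x k r hk1 hkn ?_
    by_contra! hk
    have := KNN.twentyFive_le hVpos hδ0 hδ1 hkn hk
    omega
  obtain ⟨D, hD, hSD⟩ := KNN.exists_countable_subset_closure P
  set 𝓒 := KNN.rationalBalls D with h𝓒
  have hcount : 𝓒.Countable := KNN.countable_rationalBalls hD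
  have hmeas : ∀ B ∈ 𝓒, MeasurableSet B := KNN.measurableSet_of_mem_rationalBalls
  have hVC : ∀ s : Finset 𝒳, KNN.Shatters 𝓒 s → s.card ≤ V :=
    KNN.card_le_of_shatters_rationalBalls hV
  set Z : Ω → Fin n → 𝒳 × 𝒴 := fun ω i => (X i ω, Y i ω) with hZ_def
  have hZm : AEMeasurable Z μ := aemeasurable_pi_lambda _ fun i => (hlaw i).aemeasurable
  have hZlaw : μ.map Z = Measure.pi fun _ : Fin n => P ⊗ₘ κ := by
    rw [(iIndepFun_iff_map_fun_eq_pi_map fun i => (hlaw i).aemeasurable).1 hindep]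
    congr 1
    funext i
    exact (hlaw i).map_eq
  -- the exceptional events for the variance and for the bias
  set G : Equiv.Perm (Fin n) → Set (Fin n → 𝒳 × 𝒴) := fun σ =>
    {z | ∃ A ∈ KNN.candidates 𝓒 σ (fun i => (z i).1), Cker * √A.card * (1 + √(4 * L)) <
      ‖∑ j ∈ A, (KNN.featureMap H (z j).2 - KNN.meanEmbedding H (κ (z j).1))‖} with hG_def
  set F : Set (Fin n → 𝒳 × 𝒴) :=
    ⋃ k ∈ (Finset.Icc 1 n).filter fun k : ℕ => 2 + 8 * L < k,
      {z | ∃ B ∈ 𝓒, 3 * (k : ℝ) ≤ n * P.real B ∧ KNN.pointCount B (fun i => (z i).1) < k}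
    with hF_def
  have hG : ∀ σ, MeasurableSet (G σ) ∧ μ (Z ⁻¹' G σ) ≤ ENNReal.ofReal δ := fun σ => by
    obtain ⟨h1, h2⟩ := KNN.pi_exists_candidates_lt_norm_sum_le P κ hΦ hCker hΦC
      (KNN.norm_featureMap_sub_sq_le hCker hker) hcount hmeas hVC σ (L := 4 * L) (by positivity)
    refine ⟨h1, ?_⟩
    rw [← Measure.map_apply_of_aemeasurable hZm (show MeasurableSet (G σ) from h1), hZlaw]
    exact h2.trans (ENNReal.ofReal_le_ofReal
      (KNN.card_candidates_mul_exp_le hn hVpos hδ0 hδ1))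
  have hF : μ (Z ⁻¹' F) ≤ ENNReal.ofReal δ := by
    -- This inequality holds for arbitrary sets, so measurability of `F` is not needed.
    calc μ (Z ⁻¹' F) ≤ μ.map Z F := Measure.le_map_apply hZm F
      _ ≤ ENNReal.ofReal δ := by
        rw [hZlaw]
        exact KNN.pi_exists_pointCount_lt_le P κ hcount hmeas hVC hVpos hn hδ0 hδ1
  set bad : Set Ω := (⋃ σ, τ ⁻¹' {σ} ∩ Z ⁻¹' G σ) ∪ Z ⁻¹' F with hbad_def
  -- The sample is only almost everywhere measurable, so `bad` may fail to be measurable; its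
  -- measurable hull has the same measure.
  have hbad : μ.real (toMeasurable μ bad) ≤ 2 * δ := by
    have h1 : μ bad ≤ ENNReal.ofReal (2 * δ) := by
      rw [two_mul, ENNReal.ofReal_add hδ0.le hδ0.le]
      refine (measure_union_le _ _).trans (add_le_add ?_ hF)
      exact KNN.measure_iUnion_preimage_inter_le hτ hτindep (fun σ => (hG σ).1)
        fun σ => (hG σ).2
    rw [Measure.real, measure_toMeasurable]
    exact ENNReal.toReal_le_of_le_ofReal (by positivity) h1
  refine ⟨(toMeasurable μ bad)ᶜ, (measurableSet_toMeasurable _ _).compl, ?_, ?_⟩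
  · rw [probReal_compl_eq_one_sub (measurableSet_toMeasurable _ _)]
    linarith
  intro ω hω x k r hk1 hkn hr hrmax' _ hkr
  have hωbad : ω ∉ bad := fun h => hω (subset_toMeasurable μ bad h)
  rcases le_or_gt (k : ℝ) (2 + 8 * L) with hk | hk
  · exact htrivial ω x k r hk1 hkn hk
  have hn0 : (0 : ℝ) < n := by exact_mod_cast (by omega : 0 < n)
  have hk0 : (0 : ℝ) < k := by exact_mod_cast hk1
  have ha : 0 < P.real (Metric.closedBall x r) := by
    have h1 : 0 < P.real (Metric.closedBall x r) / (3 * Cdist) := lt_trans (by positivity) hkr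
    exact (div_pos_iff_of_pos_right (by positivity)).1 h1
  -- The strict bound on `k / n` forces `P(B(x,r)) > 0`, and doubling carries positivity to every
  -- radius.
  have hx : x ∈ closure D := hSD fun s hs =>
    KNN.measure_closedBall_pos_of_doubling P ha hr hCdist (fun ε => hdoubling x r ε hr hrmax') hs
  obtain ⟨ε, hε0, hε1, hε2, hε⟩ := KNN.exists_scale ha hn0 hk0 hCdist hd hkr
  have hmass := hε _ (hdoubling x r ε hr hrmax' hε0 hε1)
  -- the nearest neighbours are close to `x`
  have hclose : ∀ j ∈ KNN.nearest (fun i => X i ω) (τ ω) k x, dist x (X j ω) ≤ ε * r := by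
    classical
    intro j hj
    refine KNN.dist_le_of_mem_nearest (fun i => X i ω) (τ ω) x ?_ hj
    obtain ⟨B, hB, hsub, hiff⟩ := KNN.exists_mem_rationalBalls hx
      (show 0 ≤ ε * r by positivity) (fun i => X i ω)
    -- The rational ball `B` contains the ball of radius `ε * r`, hence has mass at least `3 * k /
    -- n`, yet holds the same covariates. Too few of them would place `ω` in the bias event.
    by_contra! hlt
    refine hωbad (Or.inr ?_)
    refine Set.mem_biUnion (x := k) (by simp [hk1, hkn, hk]) ⟨B, hB, hmass.trans ?_, ?_⟩
    · exact mul_le_mul_of_nonneg_left (measureReal_mono hsub) hn0.le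
    · simp only [KNN.pointCount, hZ_def, hiff]
      convert hlt
  -- the responses of the nearest neighbours deviate little from their conditional means
  have hvar : ‖∑ j ∈ KNN.nearest (fun i => X i ω) (τ ω) k x,
      (KNN.featureMap H (Y j ω) - KNN.meanEmbedding H (κ (X j ω)))‖ ≤
      Cker * √(KNN.nearest (fun i => X i ω) (τ ω) k x).card * (1 + √(4 * L)) := by
    by_contra! hlt
    refine hωbad (Or.inl (Set.mem_iUnion.2 ⟨τ ω, rfl, ?_⟩))
    exact ⟨_, KNN.nearest_mem_candidates hx (fun i => X i ω) (τ ω) hk1 hkn, hlt⟩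
  have hcard := KNN.card_nearest (fun i => X i ω) (τ ω) x hkn
  have hfinal := KNN.norm_sub_average_sq_le (KNN.nearest (fun i => X i ω) (τ ω) k x) (by omega)
    (KNN.meanEmbedding H (κ x)) (fun j => KNN.meanEmbedding H (κ (X j ω)))
    (fun j => KNN.featureMap H (Y j ω)) (b := lam * (ε * r)) (by positivity)
    (fun j hj => (hLip x (X j ω)).trans (by gcongr; exact hclose j hj)) hvar
  rw [hcard] at hfinal
  rw [KNN.meanEmbedding_knnDist hΦ]
  refine hfinal.trans (le_of_eq ?_)
  rw [← hε2]
  ring
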